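/- Conventions. Let $\widehat{\mathbb C}$ be the Riemann sphere; closures, interiors and boundaries are taken in $\widehat{\mathbb C}$. Put $\rho_0(w)=|w|^{-2}$ and $dA=\frac{1}{\pi}\,dx\,dy$; contour integrals carry the normalizing factor $\frac{1}{2\pi i}$, and $\partial\Omega$ is positively oriented (with $\Omega$ on its left). For a domain $\Omega\subset\widehat{\mathbb C}$ let $A(\Omega)$ be the set of functions that are analytic in $\Omega$ (also at $\infty$ if $\infty\in\Omega$) and continuous on $\overline\Omega$, and let $L^1_a(\Omega;\rho_0)$ be the set of $f\in A(\Omega)$ with $\int_\Omega |f|\rho_0\,dA<\infty$. Let $h$ be a rational function all of whose poles lie in $\Omega$ and which, if $\infty\notin\Omega$, vanishes at $\infty$. We write $\Omega\in QD_0(h)$ if $\Omega\subset\widehat{\mathbb C}$ is a domain (open, connected, non-empty) with rectifiable boundary (of finite length), with $\Omega=\operatorname{int}(\overline\Omega)$ and $0,\infty\notin\partial\Omega$, such that $$\int_\Omega \frac{f(w)}{|w|^2}\,dA(w)=\oint_{\partial\Omega} f(w)h(w)\,dw\qquad\text{for all } f\in L^1_a(\Omega;\rho_0).$$ Theorem.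 Let $\Omega\neq\widehat{\mathbb C}$ be a domain, bounded or with $\infty\in\Omega$, such that $\Omega\in QD_0(h)$ and $0\in\Omega$. Then there exist a unique $q\in\mathbb C$ and a unique $G\in A(\Omega)$ such that $$\frac{\ln|w|^2}{w}=h(w)+\frac{q}{w}+G(w)\qquad\text{for all } w\in\partial\Omega .$$ Moreover, $G$ is the $\rho_0$-weighted Cauchy transform of the exterior $\Omega^{e}=\widehat{\mathbb C}\setminus\overline\Omega$: for every $w\in\overline\Omega$, $$G(w)=\int_{\Omega^{e}}\frac{|\xi|^{-2}}{w-\xi}\,dA(\xi),$$ where the integral converges absolutely (and $G(\infty)=0$ if $\infty\in\Omega$). -/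

import Mathlib

open MeasureTheory
open scoped NNReal ENNReal

noncomputable section

namespace LQD

/-! The Riemann sphere is modelled by `OnePoint ℂ`. -/

/-- The finite part of a subset of the sphere. -/
def finitePart (U : Set (OnePoint ℂ)) : Set ℂ := {z : ℂ | (z : OnePoint ℂ) ∈ U}

/-- The exterior of a subset of the sphere: the complement of its closure. -/
def sphereExt (U : Set (OnePoint ℂ)) : Set (OnePoint ℂ) := (closure U)ᶜ

/-- The coordinate `ζ ↦ 1 / ζ` of the sphere at infinity, with `0 ↦ ∞`. -/
def chartInfty (ζ : ℂ) : OnePoint ℂ :=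
  if ζ = 0 then OnePoint.infty else ((ζ⁻¹ : ℂ) : OnePoint ℂ)

/-- `f` is analytic on the open subset `U` of the sphere: it is holomorphic in each of the two
standard coordinates `z` and `1 / z`. -/
def AnalyticOnSphere (f : OnePoint ℂ → ℂ) (U : Set (OnePoint ℂ)) : Prop :=
  DifferentiableOn ℂ (fun z : ℂ => f (z : OnePoint ℂ)) (finitePart U) ∧
    DifferentiableOn ℂ (fun ζ : ℂ => f (chartInfty ζ)) (chartInfty ⁻¹' U)

/-- The class `A(Ω)`: analytic in `Ω` and continuous on the closure of `Ω` (in the sphere). Only the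
values of `f` on the closure of `Ω` matter. -/
def MemA (Ω : Set (OnePoint ℂ)) (f : OnePoint ℂ → ℂ) : Prop :=
  AnalyticOnSphere f Ω ∧ ContinuousOn f (closure Ω)

/-- The weight `ρ₀(w) = |w|⁻²`. -/
def rho0 (w : ℂ) : ℝ := (‖w‖ ^ 2)⁻¹

/-- The class `L¹ₐ(Ω; ρ)`: the functions of `A(Ω)` that are absolutely integrable over `Ω` with
respect to the weight `ρ`. -/
def MemL1a (Ω : Set (OnePoint ℂ)) (ρ : ℂ → ℝ) (f : OnePoint ℂ → ℂ) : Prop :=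
  MemA Ω f ∧ IntegrableOn (fun z : ℂ => f (z : OnePoint ℂ) * (ρ z : ℂ)) (finitePart Ω)

/-- The integral over `U` with respect to the normalized area measure `dA = dx dy / π`. -/
def areaIntegral (U : Set (OnePoint ℂ)) (g : ℂ → ℂ) : ℂ :=
  (Real.pi : ℂ)⁻¹ * ∫ z in finitePart U, g z

/-- The Cauchy kernel `ξ ↦ ρ(ξ) / (w - ξ)` with the weight `ρ`, which is zero for `w = ∞`. -/
def cauchyKernel (ρ : ℂ → ℝ) : OnePoint ℂ → ℂ → ℂ
  | Option.none, _ => 0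
  | Option.some w, ξ => (ρ ξ : ℂ) / (w - ξ)

/-- The `ρ`-weighted Cauchy transform of `U`, `w ↦ ∫_U ρ(ξ) / (w - ξ) dA(ξ)`; its value at `∞`
is zero. -/
def cauchyTransform (ρ : ℂ → ℝ) (U : Set (OnePoint ℂ)) (w : OnePoint ℂ) : ℂ :=
  areaIntegral U (cauchyKernel ρ w)

/-- A countable family of closed rectifiable curves in the plane of finite total length. Each curve
is given by a Lipschitz parametrization on `[0, 1]` (for instance one of constant speed), and the
Lipschitz constants are summable. -/
structure CurveFamily where
  curve : ℕ → ℝ → ℂ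
  speed : ℕ → ℝ≥0
  closed : ∀ i, curve i 0 = curve i 1
  lipschitz : ∀ i, LipschitzOnWith (speed i) (curve i) (Set.Icc 0 1)
  summable_speed : Summable speed

/-- The contour integral `(1 / 2πi) ∑ᵢ ∫_{γᵢ} F(w) dw` along a family of closed curves. -/
def CurveFamily.integral (Γ : CurveFamily) (F : ℂ → ℂ) : ℂ :=
  ∑' i, (2 * Real.pi * Complex.I : ℂ)⁻¹ *
    ∫ t in (0 : ℝ)..1, F (Γ.curve i t) * deriv (Γ.curve i) t

/-- `Γ` parametrizes the boundary of `Ω` with positive orientation (`Ω` lies on the left): its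
curves lie on the boundary, and its total winding number about a point `a` off the boundary is
`1` on `Ω` and `0` off `Ω` if `∞ ∉ Ω`, and `0` on `Ω` and `-1` off `Ω` if `∞ ∈ Ω`. These conditions
determine the integral along `Γ` of every function that is continuous on the boundary. -/
def CurveFamily.IsBoundary (Γ : CurveFamily) (Ω : Set (OnePoint ℂ)) : Prop :=
  (∀ i, ∀ t ∈ Set.Icc (0 : ℝ) 1, (Γ.curve i t : OnePoint ℂ) ∈ frontier Ω) ∧
    ∀ a : ℂ, (a : OnePoint ℂ) ∉ frontier Ω →
      Γ.integral (fun ξ => (ξ - a)⁻¹) =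
        Set.indicator Ω (fun _ => (1 : ℂ)) (a : OnePoint ℂ) -
          Set.indicator Ω (fun _ => (1 : ℂ)) OnePoint.infty

/-- The value of a rational function at a point of the plane. -/
def ratVal (h : RatFunc ℂ) (z : ℂ) : ℂ := h.eval (RingHom.id ℂ) z

/-- The rational functions admitted as quadrature functions: all the poles lie in `Ω`, where `∞`
may be a pole only if `∞ ∈ Ω`, and `h` vanishes at `∞` if `∞ ∉ Ω`. -/
def AdmissibleRat (Ω : Set (OnePoint ℂ)) (h : RatFunc ℂ) : Prop :=
  (∀ z : ℂ, h.denom.IsRoot z → (z : OnePoint ℂ) ∈ Ω) ∧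
    (OnePoint.infty ∉ Ω → h.num.degree < h.denom.degree)

/-- `Ω ∈ QD₀(h)`: `Ω` is a log-weighted quadrature domain with quadrature function `h`. -/
structure IsLQD (Ω : Set (OnePoint ℂ)) (h : RatFunc ℂ) : Prop where
  isOpen : IsOpen Ω
  isConnected : IsConnected Ω
  interior_closure : interior (closure Ω) = Ω
  zero_notMem_frontier : ((0 : ℂ) : OnePoint ℂ) ∉ frontier Ω
  infty_notMem_frontier : OnePoint.infty ∉ frontier Ω
  /-- the boundary has finite length -/
  rectifiable : Measure.hausdorffMeasure 1 (finitePart (frontier Ω)) < ⊤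
  admissible : AdmissibleRat Ω h
  /-- the quadrature identity -/
  quadrature : ∃ Γ : CurveFamily, Γ.IsBoundary Ω ∧
    ∀ f : OnePoint ℂ → ℂ, MemL1a Ω rho0 f →
      areaIntegral Ω (fun w => f (w : OnePoint ℂ) * (rho0 w : ℂ)) =
        Γ.integral (fun w => f (w : OnePoint ℂ) * ratVal h w)

/-- The coincidence equation `ln|w|² / w = h(w) + q / w + G(w)` on the boundary of `Ω`. -/
def CoincidenceEq (Ω : Set (OnePoint ℂ)) (h : RatFunc ℂ) (q : ℂ) (G : OnePoint ℂ → ℂ) : Prop :=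
  ∀ w : ℂ, (w : OnePoint ℂ) ∈ frontier Ω →
    (Real.log (‖w‖ ^ 2) : ℂ) / w = ratVal h w + q / w + G (w : OnePoint ℂ)

end LQD

end

/-! Let `E` be the finite part of the exterior, `G` its weighted Cauchy transform, and take `ξ, ξ'`
in `E`. The test function `f(w) = ξ / (w - ξ) - ξ' / (w - ξ')` is admissible: it vanishes at `0`, so
`f ρ₀` is only `O(1 / |w|)` there, and it is `O(1 / |w|)` at `∞`. A single Cauchy kernel would not
be integrable against `ρ₀` near `0`.

Both sides of the quadrature identity can be computed for `f`. Since the poles of `h` lie in `Ω`,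
the exterior Cauchy formula (`cauchyFormula_ratVal`) gives `-ξ h(ξ) + ξ' h(ξ')` for the contour
integral. The area integral over `Ω` is the one over the plane minus the one over `E`, because a
boundary of finite length has zero area. Over the plane, polar coordinates give `log |ξ'|² - log
|ξ|²` (`integral_testFun_mul_rho0`); over `E` the result is `-ξ G(ξ) + ξ' G(ξ')`. Separating the
variables, `w h + w G - log |w|²` is constant on `E` (`coincidenceDefect_eq`). By continuity it is
constant up to `∂Ω`, and `q` is minus the constant.

As `0 ∈ Ω`, the weight is bounded on `E`. Hence `G` is continuous on the plane, holomorphic off the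
closure of `E`, and tends to `0` at `∞` when `E` is bounded, so `G ∈ A(Ω)`.

For uniqueness, the difference `D` of two candidates equals `c / w` on `∂Ω`. The maximum principle
extends `w D = c` to `Ω`, after an exterior point has been sent to infinity; at `w = 0` this forces
`c = 0`, and then `D = 0` (`eqOn_zero_of_eq_div`). -/

noncomputable section

namespace LQD

/-! ### Contour integrals along Lipschitz curves -/

section Curve

variable {f : ℝ → ℂ} {C : ℝ≥0}

theorem ae_differentiableAt_of_lipschitzOnWith (hf : LipschitzOnWith C f (Set.Icc 0 1)) :
    ∀ᵐ t : ℝ, t ∈ Set.Ioo (0 : ℝ) 1 → DifferentiableAt ℝ f t := by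
  filter_upwards [hf.ae_differentiableWithinAt_of_mem] with t ht htI
  exact (ht (Set.Ioo_subset_Icc_self htI)).differentiableAt (Icc_mem_nhds htI.1 htI.2)

/-- The curves are controlled only on `[0, 1]`, so the two-sided `deriv` is meaningful only at
interior points; the endpoint is a null set. -/
theorem ae_Ioo_restrict {p : ℝ → Prop} (h : ∀ᵐ t : ℝ, t ∈ Set.Ioo (0 : ℝ) 1 → p t) :
    ∀ᵐ t : ℝ, t ∈ Set.uIoc (0 : ℝ) 1 → p t := by
  have h1 : ∀ᵐ t : ℝ, t ≠ 1 := by simp [ae_iff]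
  filter_upwards [h, h1] with t ht ht1 htI
  rw [Set.uIoc_of_le zero_le_one] at htI
  exact ht ⟨htI.1, lt_of_le_of_ne htI.2 ht1⟩

theorem norm_deriv_le_of_lipschitzOnWith_Icc (hf : LipschitzOnWith C f (Set.Icc 0 1))
    {t : ℝ} (ht : t ∈ Set.Ioo (0 : ℝ) 1) : ‖deriv f t‖ ≤ C :=
  norm_deriv_le_of_lipschitzOn (Icc_mem_nhds ht.1 ht.2) hf

theorem ae_norm_mul_deriv_le (hf : LipschitzOnWith C f (Set.Icc 0 1)) {v : ℝ → ℂ} {M : ℝ}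
    (hv : ∀ t ∈ Set.Icc (0 : ℝ) 1, ‖v t‖ ≤ M) :
    ∀ᵐ t : ℝ, t ∈ Set.uIoc (0 : ℝ) 1 → ‖v t * deriv f t‖ ≤ M * C := by
  refine ae_Ioo_restrict (Filter.Eventually.of_forall fun t ht => ?_)
  rw [norm_mul]
  have := hv t (Set.Ioo_subset_Icc_self ht)
  exact mul_le_mul this (norm_deriv_le_of_lipschitzOnWith_Icc hf ht) (norm_nonneg _)
    ((norm_nonneg _).trans this)

theorem intervalIntegrable_mul_deriv (hf : LipschitzOnWith C f (Set.Icc 0 1)) {v : ℝ → ℂ}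
    (hv : ContinuousOn v (Set.Icc 0 1)) :
    IntervalIntegrable (fun t => v t * deriv f t) volume 0 1 := by
  obtain ⟨M, hM⟩ := isCompact_Icc.exists_bound_of_continuousOn hv
  have hb := ae_norm_mul_deriv_le hf hM
  rw [Set.uIoc_of_le zero_le_one] at hb
  rw [intervalIntegrable_iff_integrableOn_Ioc_of_le zero_le_one]
  refine Integrable.of_bound (C := M * C) ?_ ?_
  · refine AEStronglyMeasurable.mul ?_ (measurable_deriv f).aestronglyMeasurable
    exact (hv.mono Set.Ioc_subset_Icc_self).aestronglyMeasurable measurableSet_Ioc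
  · exact (ae_restrict_iff' measurableSet_Ioc).2 hb

/-- The real and imaginary parts are absolutely continuous, and the fundamental theorem of calculus
applies to each. -/
theorem integral_deriv_eq_sub_of_lipschitzOnWith (hf : LipschitzOnWith C f (Set.Icc 0 1)) :
    ∫ t in (0 : ℝ)..1, deriv f t = f 1 - f 0 := by
  have hint : IntervalIntegrable (fun t => deriv f t) volume 0 1 := by
    simpa using intervalIntegrable_mul_deriv hf (v := fun _ => 1) continuousOn_const
  have hd := ae_Ioo_restrict (ae_differentiableAt_of_lipschitzOnWith hf)
  have key (L : ℂ →L[ℝ] ℝ) : L (∫ t in (0 : ℝ)..1, deriv f t) = L (f 1) - L (f 0) := by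
    rw [← L.intervalIntegral_comp_comm hint]
    have hL : AbsolutelyContinuousOnInterval (fun t => L (f t)) 0 1 := by
      refine LipschitzOnWith.absolutelyContinuousOnInterval (K := ‖L‖₊ * C) ?_
      rw [Set.uIcc_of_le zero_le_one]
      exact L.lipschitz.comp_lipschitzOnWith hf
    rw [← hL.integral_deriv_eq_sub]
    refine intervalIntegral.integral_congr_ae ?_
    filter_upwards [hd] with t ht htI
    exact ((L.hasFDerivAt.comp_hasDerivAt t (ht htI).hasDerivAt).deriv).symm
  apply Complex.ext
  · simpa using key Complex.reCLM
  · simpa using key Complex.imCLM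

/-- A `C¹` function is Lipschitz on the compact trace of the curve, so `F ∘ f` is again a closed
Lipschitz curve. -/
theorem integral_deriv_comp_mul_deriv_eq_zero (hf : LipschitzOnWith C f (Set.Icc 0 1))
    (hcl : f 0 = f 1) {F : ℂ → ℂ}
    (hF : ∀ t ∈ Set.Icc (0 : ℝ) 1, ContDiffAt ℂ 1 F (f t)) :
    ∫ t in (0 : ℝ)..1, deriv F (f t) * deriv f t = 0 := by
  have hloc : LocallyLipschitzOn (f '' Set.Icc 0 1) F := by
    rintro _ ⟨t, ht, rfl⟩
    obtain ⟨K, s, hs, hK⟩ := (hF t ht).exists_lipschitzOnWith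
    exact ⟨K, s, mem_nhdsWithin_of_mem_nhds hs, hK⟩
  obtain ⟨K, hK⟩ := hloc.exists_lipschitzOnWith_of_compact
    (isCompact_Icc.image_of_continuousOn hf.continuousOn)
  have hFf := hK.comp hf (Set.mapsTo_image f (Set.Icc 0 1))
  have h := integral_deriv_eq_sub_of_lipschitzOnWith hFf
  simp only [Function.comp, hcl, sub_self] at h
  rw [← h]
  refine intervalIntegral.integral_congr_ae ?_
  filter_upwards [ae_Ioo_restrict (ae_differentiableAt_of_lipschitzOnWith hf)] with t ht htI
  have htI' : t ∈ Set.Icc (0 : ℝ) 1 := by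
    rw [Set.uIoc_of_le zero_le_one] at htI
    exact Set.Ioc_subset_Icc_self htI
  have hFd := ((hF t htI').differentiableAt one_ne_zero).hasDerivAt
  exact (HasDerivAt.comp t hFd (ht htI).hasDerivAt).deriv.symm

end Curve

/-! ### Contour integrals along families of curves -/

namespace CurveFamily

variable {Γ : CurveFamily} {K : Set ℂ} {u v : ℂ → ℂ}

theorem integral_congr (hΓ : ∀ i, ∀ t ∈ Set.Icc (0 : ℝ) 1, Γ.curve i t ∈ K)
    (huv : Set.EqOn u v K) : Γ.integral u = Γ.integral v := by
  unfold CurveFamily.integral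
  congr 1 with i
  congr 1
  refine intervalIntegral.integral_congr fun t ht => ?_
  rw [Set.uIcc_of_le zero_le_one] at ht
  simp only [huv (hΓ i t ht)]

theorem integral_const_mul (Γ : CurveFamily) (c : ℂ) (u : ℂ → ℂ) :
    Γ.integral (fun z => c * u z) = c * Γ.integral u := by
  unfold CurveFamily.integral
  rw [← tsum_mul_left]
  congr 1 with i
  simp only [mul_assoc, intervalIntegral.integral_const_mul]
  ring

theorem continuousOn_comp_curve (hΓ : ∀ i, ∀ t ∈ Set.Icc (0 : ℝ) 1, Γ.curve i t ∈ K)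
    (hu : ContinuousOn u K) (i : ℕ) : ContinuousOn (fun t => u (Γ.curve i t)) (Set.Icc 0 1) :=
  hu.comp (Γ.lipschitz i).continuousOn (hΓ i)

theorem summable_integral (hK : IsCompact K)
    (hΓ : ∀ i, ∀ t ∈ Set.Icc (0 : ℝ) 1, Γ.curve i t ∈ K) (hu : ContinuousOn u K) :
    Summable fun i => (2 * Real.pi * Complex.I : ℂ)⁻¹ *
      ∫ t in (0 : ℝ)..1, u (Γ.curve i t) * deriv (Γ.curve i) t := by
  obtain ⟨M, hM⟩ := hK.exists_bound_of_continuousOn hu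
  refine Summable.mul_left _ (Summable.of_norm_bounded
    (g := fun i => M * (Γ.speed i : ℝ)) ?_ fun i => ?_)
  · exact (NNReal.summable_coe.2 Γ.summable_speed).mul_left M
  · have := intervalIntegral.norm_integral_le_of_norm_le_const_ae
      (ae_norm_mul_deriv_le (Γ.lipschitz i) fun t ht => hM _ (hΓ i t ht))
    simpa using this

theorem integral_add (hK : IsCompact K)
    (hΓ : ∀ i, ∀ t ∈ Set.Icc (0 : ℝ) 1, Γ.curve i t ∈ K) (hu : ContinuousOn u K)
    (hv : ContinuousOn v K) :
    Γ.integral (fun z => u z + v z) = Γ.integral u + Γ.integral v := by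
  unfold CurveFamily.integral
  rw [← (summable_integral hK hΓ hu).tsum_add (summable_integral hK hΓ hv)]
  congr 1 with i
  rw [← mul_add, ← intervalIntegral.integral_add
    (intervalIntegrable_mul_deriv (Γ.lipschitz i) (continuousOn_comp_curve hΓ hu i))
    (intervalIntegrable_mul_deriv (Γ.lipschitz i) (continuousOn_comp_curve hΓ hv i))]
  simp only [add_mul]

theorem integral_sub (hK : IsCompact K)
    (hΓ : ∀ i, ∀ t ∈ Set.Icc (0 : ℝ) 1, Γ.curve i t ∈ K) (hu : ContinuousOn u K)
    (hv : ContinuousOn v K) :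
    Γ.integral (fun z => u z - v z) = Γ.integral u - Γ.integral v := by
  have := integral_add hK hΓ hu (v := fun z => -1 * v z) (continuousOn_const.mul hv)
  rw [integral_const_mul] at this
  rw [sub_eq_add_neg, ← neg_one_mul, ← this]
  congr 1 with z
  ring

theorem integral_deriv_eq_zero (hΓ : ∀ i, ∀ t ∈ Set.Icc (0 : ℝ) 1, Γ.curve i t ∈ K)
    (hu : ∀ z ∈ K, ContDiffAt ℂ 1 u z) : Γ.integral (deriv u) = 0 := by
  unfold CurveFamily.integral
  simp only [integral_deriv_comp_mul_deriv_eq_zero (Γ.lipschitz _) (Γ.closed _)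
    fun t ht => hu _ (hΓ _ t ht), mul_zero, tsum_zero]

theorem integral_pow (hΓ : ∀ i, ∀ t ∈ Set.Icc (0 : ℝ) 1, Γ.curve i t ∈ K) (n : ℕ) :
    Γ.integral (fun z => z ^ n) = 0 := by
  have h := integral_deriv_eq_zero hΓ (u := fun z => ((n : ℂ) + 1)⁻¹ * z ^ (n + 1))
    fun z _ => by fun_prop
  rw [← h]
  congr 1 with z
  have hn : (n : ℂ) + 1 ≠ 0 := by exact_mod_cast n.succ_ne_zero
  simp [hn]

/-- A pole of order at least two has a single-valued primitive, so no winding number enters. -/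
theorem integral_inv_sub_pow (hΓ : ∀ i, ∀ t ∈ Set.Icc (0 : ℝ) 1, Γ.curve i t ∈ K) {p : ℂ}
    (hp : p ∉ K) (n : ℕ) : Γ.integral (fun z => ((z - p) ^ (n + 2))⁻¹) = 0 := by
  have hn : (n : ℂ) + 1 ≠ 0 := by exact_mod_cast n.succ_ne_zero
  have hne (z : ℂ) (hz : z ∈ K) : z - p ≠ 0 := sub_ne_zero.2 fun h => hp (h ▸ hz)
  have h := integral_deriv_eq_zero hΓ (u := fun z => -((n : ℂ) + 1)⁻¹ * ((z - p) ^ (n + 1))⁻¹)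
    fun z hz => contDiffAt_const.mul
      (ContDiffAt.inv (by fun_prop) (pow_ne_zero _ (hne z hz)))
  rw [← h]
  refine integral_congr hΓ fun z hz => ?_
  have hz' := hne z hz
  have hd : HasDerivAt (fun z => (z - p) ^ (n + 1)) (((n : ℂ) + 1) * (z - p) ^ n) z := by
    simpa using ((hasDerivAt_id z).sub_const p).fun_pow (n + 1)
  have := ((hd.inv (pow_ne_zero _ hz')).const_mul (-((n : ℂ) + 1)⁻¹)).deriv
  simp only [Pi.inv_apply] at this
  erw [this]
  field_simp
  ring

end CurveFamily

/-! ### Principal parts of rational functions -/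

/-- Finite sums of principal parts with poles in `S`, up to their values on `S`. -/
inductive PrincipalSum (S : Set ℂ) : (ℂ → ℂ) → Prop
  | zero : PrincipalSum S fun _ => 0
  | pole (p : ℂ) (hp : p ∈ S) (k : ℕ) : PrincipalSum S fun w => ((w - p) ^ (k + 1))⁻¹
  | add (u v : ℂ → ℂ) : PrincipalSum S u → PrincipalSum S v → PrincipalSum S fun w => u w + v w
  | smul (c : ℂ) (u : ℂ → ℂ) : PrincipalSum S u → PrincipalSum S fun w => c * u w
  | congr (u v : ℂ → ℂ) : PrincipalSum S u → Set.EqOn u v Sᶜ → PrincipalSum S v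

namespace PrincipalSum

variable {S : Set ℂ} {u : ℂ → ℂ}

/-- For `p ≠ q`, the identity `1 / ((w - p)(w - q)) = (1 / (w - p) - 1 / (w - q)) / (p - q)` lowers
the order of the pole at `p` by one. -/
theorem pole_mul_inv_sub {p q : ℂ} (hp : p ∈ S) (hq : q ∈ S) (k : ℕ) :
    PrincipalSum S fun w => ((w - p) ^ (k + 1))⁻¹ * (w - q)⁻¹ := by
  have hne {w a : ℂ} (hw : w ∈ Sᶜ) (ha : a ∈ S) : w - a ≠ 0 :=
    sub_ne_zero.2 fun h => hw (h ▸ ha)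
  rcases eq_or_ne p q with rfl | hpq
  · refine (PrincipalSum.pole p hp (k + 1)).congr _ _ fun w _ => ?_
    simp [pow_succ, mul_comm]
  have hpq' : p - q ≠ 0 := sub_ne_zero.2 hpq
  induction k with
  | zero =>
    refine (((PrincipalSum.pole p hp 0).add _ _
      ((PrincipalSum.pole q hq 0).smul (-1) _)).smul (p - q)⁻¹ _).congr _ _ fun w hw => ?_
    have h1 := hne hw hp
    have h2 := hne hw hq
    simp only [zero_add, pow_one]
    field_simp
    ring
  | succ k ih =>
    refine (((PrincipalSum.pole p hp (k + 1)).add _ _ (ih.smul (-1) _)).smul (p - q)⁻¹ _).congr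
      _ _ fun w hw => ?_
    have h1 := hne hw hp
    have h2 := hne hw hq
    simp only
    field_simp
    ring

theorem mul_inv_sub (hu : PrincipalSum S u) {q : ℂ} (hq : q ∈ S) :
    PrincipalSum S fun w => u w * (w - q)⁻¹ := by
  induction hu with
  | zero => exact PrincipalSum.zero.congr _ _ fun w _ => by simp
  | pole p hp k => exact pole_mul_inv_sub hp hq k
  | add u v _ _ hu hv => exact (hu.add _ _ hv).congr _ _ fun w _ => by simp [add_mul]
  | smul c u _ hu => exact (hu.smul c _).congr _ _ fun w _ => by simp [mul_assoc]
  | congr u v _ huv hu => exact hu.congr _ _ fun w hw => by simp only [huv hw]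

open Polynomial in
-- Writing `P = P(a) + (w - a) Q` cancels one root in the second term and leaves a constant
-- numerator in the first, which is handled by adjoining the simple factors one at a time.
theorem eval_div_prod (s : Multiset ℂ) (hs : ∀ a ∈ s, a ∈ S) :
    ∀ P : ℂ[X], P.degree < Multiset.card s →
      PrincipalSum S fun w => P.eval w / (s.map fun a => w - a).prod := by
  induction s using Multiset.induction with
  | empty =>
    intro P hP
    have : P = 0 := by
      rw [← Polynomial.degree_eq_bot]
      rw [Multiset.card_zero] at hP
      exact Nat.WithBot.lt_zero_iff.1 hP
    exact PrincipalSum.zero.congr _ _ fun w _ => by simp [this]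
  | cons a s ih =>
    have ha := hs a (Multiset.mem_cons_self a s)
    have hs' : ∀ b ∈ s, b ∈ S := fun b hb => hs b (Multiset.mem_cons_of_mem hb)
    replace ih := ih hs'
    have hne {w b : ℂ} (hw : w ∈ Sᶜ) (hb : b ∈ S) : w - b ≠ 0 :=
      sub_ne_zero.2 fun h => hw (h ▸ hb)
    have hone : PrincipalSum S fun w => 1 / ((a ::ₘ s).map fun a => w - a).prod := by
      clear ih hs
      induction s using Multiset.induction with
      | empty =>
        refine (PrincipalSum.pole a ha 0).congr _ _ fun w _ => ?_
        simp
      | cons b s ih2 =>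
        have hb := hs' b (Multiset.mem_cons_self b s)
        refine ((ih2 fun c hc => hs' c (Multiset.mem_cons_of_mem hc)).mul_inv_sub hb).congr _ _
          fun w _ => ?_
        simp only [Multiset.map_cons, Multiset.prod_cons, one_div, mul_inv]
        ring
    intro P hP
    have hdecomp := P.modByMonic_add_div (X - C a)
    rw [Polynomial.modByMonic_X_sub_C_eq_C_eval] at hdecomp
    have hdeg : (P /ₘ (X - C a)).degree < Multiset.card s := by
      rcases eq_or_ne (P /ₘ (X - C a)) 0 with h0 | h0
      · rw [h0, degree_zero]; exact WithBot.bot_lt_coe _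
      · have hP0 : P ≠ 0 := fun h => h0 (by simp [h])
        rw [degree_eq_natDegree h0]
        rw [degree_eq_natDegree hP0, Multiset.card_cons] at hP
        have hP' : P.natDegree < Multiset.card s + 1 := by exact_mod_cast hP
        have h1 := natDegree_divByMonic P (monic_X_sub_C a)
        rw [natDegree_X_sub_C] at h1
        -- The degree of the quotient is the truncated `P.natDegree - 1`, so the strict bound needs
        -- `P` nonconstant when `s` is empty.
        have h2 : P.natDegree ≠ 0 := by
          intro h
          apply h0
          rw [Polynomial.eq_C_of_natDegree_eq_zero h]
          exact (divByMonic_eq_zero_iff (monic_X_sub_C a)).2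
            (lt_of_le_of_lt degree_C_le (by simp))
        have : (P /ₘ (X - C a)).natDegree < Multiset.card s := by omega
        exact_mod_cast this
    refine ((ih _ hdeg).add _ _ (hone.smul (P.eval a) _)).congr _ _ fun w hw => ?_
    have hw' := hne hw ha
    have hev : P.eval w = P.eval a + (w - a) * (P /ₘ (X - C a)).eval w := by
      conv_lhs => rw [← hdecomp]
      simp
    have hprod : (s.map fun a => w - a).prod ≠ 0 := by
      refine Multiset.prod_ne_zero fun h0 => ?_
      obtain ⟨b, hb, hb0⟩ := Multiset.mem_map.1 h0
      exact hne hw (hs' b hb) hb0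
    simp only [Multiset.map_cons, Multiset.prod_cons, hev]
    field_simp
    ring

open Polynomial in
theorem eval_div_eval {P Q : ℂ[X]} (hQ : Q ≠ 0) (hPQ : P.degree < Q.degree)
    (hroots : ∀ z, Q.IsRoot z → z ∈ S) : PrincipalSum S fun w => P.eval w / Q.eval w := by
  have hsplit := IsAlgClosed.splits Q
  have hcard : Q.degree = Multiset.card Q.roots := hsplit.degree_eq_card_roots hQ
  refine ((eval_div_prod Q.roots (fun a ha => hroots a (isRoot_of_mem_roots ha)) P
    (hcard ▸ hPQ)).smul Q.leadingCoeff⁻¹ _).congr _ _ fun w _ => ?_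
  have : Q.eval w = Q.leadingCoeff * (Q.roots.map fun a => w - a).prod := by
    conv_lhs => rw [hsplit.eq_prod_roots]
    simp [eval_multiset_prod, Multiset.map_map]
  simp only [this]
  field_simp

end PrincipalSum

/-! ### The exterior Cauchy formula for rational functions -/

section

variable {Γ : CurveFamily} {K S E : Set ℂ} {κ : ℂ} {u : ℂ → ℂ}

/-- Curves on `K` whose total winding number is `κ` on `S` and `κ - 1` on `E`. -/
structure CurveFamily.Separates (Γ : CurveFamily) (K S E : Set ℂ) (κ : ℂ) : Prop where
  isCompact : IsCompact K
  mem : ∀ i, ∀ t ∈ Set.Icc (0 : ℝ) 1, Γ.curve i t ∈ K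
  disjoint_left : ∀ z ∈ K, z ∉ S
  disjoint_right : ∀ z ∈ K, z ∉ E
  disjoint : ∀ z ∈ S, z ∉ E
  index_left : ∀ a ∈ S, Γ.integral (fun z => (z - a)⁻¹) = κ
  index_right : ∀ a ∈ E, Γ.integral (fun z => (z - a)⁻¹) = κ - 1

namespace CurveFamily.Separates

theorem continuousOn_inv_sub {a : ℂ} (ha : a ∉ K) :
    ContinuousOn (fun z => (z - a)⁻¹) K :=
  (continuousOn_id.sub continuousOn_const).inv₀ fun z hz =>
    sub_ne_zero.2 fun h : z = a => ha (h ▸ hz)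

/-- The exterior Cauchy formula holds for `u`. -/
def CauchyFormula (Γ : CurveFamily) (K E : Set ℂ) (u : ℂ → ℂ) : Prop :=
  ContinuousOn u K ∧ ∀ ξ ∈ E, Γ.integral (fun w => u w * (w - ξ)⁻¹) = -u ξ

theorem cauchyFormula_add (hΓ : Γ.Separates K S E κ) {u v : ℂ → ℂ} (hu : CauchyFormula Γ K E u)
    (hv : CauchyFormula Γ K E v) : CauchyFormula Γ K E fun w => u w + v w := by
  refine ⟨hu.1.add hv.1, fun ξ hξ => ?_⟩
  have hc := continuousOn_inv_sub fun h => hΓ.disjoint_right ξ h hξ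
  simp only [add_mul]
  rw [CurveFamily.integral_add hΓ.isCompact hΓ.mem (hu.1.fun_mul hc) (hv.1.fun_mul hc), hu.2 ξ hξ,
    hv.2 ξ hξ]
  ring

theorem cauchyFormula_smul {u : ℂ → ℂ} (c : ℂ) (hu : CauchyFormula Γ K E u) :
    CauchyFormula Γ K E fun w => c * u w := by
  refine ⟨continuousOn_const.mul hu.1, fun ξ hξ => ?_⟩
  simp only [mul_assoc]
  rw [CurveFamily.integral_const_mul, hu.2 ξ hξ]
  ring

theorem cauchyFormula_congr (hΓ : Γ.Separates K S E κ) {u v : ℂ → ℂ}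
    (hu : CauchyFormula Γ K E u) (huv : Set.EqOn u v Sᶜ) : CauchyFormula Γ K E v := by
  have hK : Set.EqOn u v K := fun z hz => huv (hΓ.disjoint_left z hz)
  refine ⟨hu.1.congr hK.symm, fun ξ hξ => ?_⟩
  rw [← huv fun h => hΓ.disjoint ξ h hξ, ← hu.2 ξ hξ]
  exact CurveFamily.integral_congr hΓ.mem fun z hz => by simp only [hK hz]

/-- Partial fractions lower the order of the pole. For a simple pole only the difference `(κ - 1) -
κ = -1` of winding numbers survives, so the value of `κ` is immaterial. -/
theorem cauchyFormula_pole (hΓ : Γ.Separates K S E κ) {p : ℂ} (hp : p ∈ S) (k : ℕ) :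
    CauchyFormula Γ K E fun w => ((w - p) ^ (k + 1))⁻¹ := by
  have hpK : p ∉ K := fun h => hΓ.disjoint_left p h hp
  have hpow (k : ℕ) : ContinuousOn (fun w => ((w - p) ^ (k + 1))⁻¹) K := by
    simpa using (continuousOn_inv_sub hpK).fun_pow (k + 1)
  refine ⟨hpow k, fun ξ hξ => ?_⟩
  have hξK : ξ ∉ K := fun h => hΓ.disjoint_right ξ h hξ
  have hc := continuousOn_inv_sub hξK
  have hξp : ξ - p ≠ 0 := sub_ne_zero.2 fun h => hΓ.disjoint p hp (h ▸ hξ)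
  induction k with
  | zero =>
    have h : Γ.integral (fun w => ((w - p) ^ (0 + 1))⁻¹ * (w - ξ)⁻¹) =
        Γ.integral (fun w => (ξ - p)⁻¹ * ((w - ξ)⁻¹ - (w - p)⁻¹)) := by
      refine CurveFamily.integral_congr hΓ.mem fun w hw => ?_
      have h1 : w - p ≠ 0 := sub_ne_zero.2 fun h => hpK (h ▸ hw)
      have h2 : w - ξ ≠ 0 := sub_ne_zero.2 fun h => hξK (h ▸ hw)
      simp only [zero_add, pow_one]
      field_simp
      ring
    rw [h, CurveFamily.integral_const_mul, CurveFamily.integral_sub hΓ.isCompact hΓ.mem hc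
      (continuousOn_inv_sub hpK), hΓ.index_left p hp, hΓ.index_right ξ hξ]
    simp
  | succ k ih =>
    have h : Γ.integral (fun w => ((w - p) ^ (k + 1 + 1))⁻¹ * (w - ξ)⁻¹) =
        Γ.integral (fun w => (ξ - p)⁻¹ *
          (((w - p) ^ (k + 1))⁻¹ * (w - ξ)⁻¹ - ((w - p) ^ (k + 2))⁻¹)) := by
      refine CurveFamily.integral_congr hΓ.mem fun w hw => ?_
      have h1 : w - p ≠ 0 := sub_ne_zero.2 fun h => hpK (h ▸ hw)
      have h2 : w - ξ ≠ 0 := sub_ne_zero.2 fun h => hξK (h ▸ hw)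
      field_simp
      ring
    rw [h, CurveFamily.integral_const_mul, CurveFamily.integral_sub hΓ.isCompact hΓ.mem
      ((hpow k).fun_mul hc) (hpow (k + 1)), ih,
      CurveFamily.integral_inv_sub_pow hΓ.mem hpK]
    simp only
    field_simp
    ring

theorem cauchyFormula_of_principalSum (hΓ : Γ.Separates K S E κ) (hu : PrincipalSum S u) :
    CauchyFormula Γ K E u := by
  induction hu with
  | zero =>
    refine ⟨continuousOn_const, fun ξ _ => ?_⟩
    simpa using CurveFamily.integral_const_mul Γ 0 (fun _ => 0)
  | pole p hp k => exact hΓ.cauchyFormula_pole hp k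
  | add u v _ _ hu hv => exact hΓ.cauchyFormula_add hu hv
  | smul c u _ hu => exact cauchyFormula_smul c hu
  | congr u v _ huv hu => exact hΓ.cauchyFormula_congr hu huv

/-- Here `κ = 0` is essential: it makes the winding number `-1` about points of `E`. The induction
divides `w ^ (n + 1)` by `w - ξ`. -/
theorem cauchyFormula_pow (hΓ : Γ.Separates K S E 0) (n : ℕ) :
    CauchyFormula Γ K E fun w => w ^ n := by
  refine ⟨by fun_prop, fun ξ hξ => ?_⟩
  have hξK : ξ ∉ K := fun h => hΓ.disjoint_right ξ h hξ
  have hc := continuousOn_inv_sub hξK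
  induction n with
  | zero => simp [hΓ.index_right ξ hξ]
  | succ n ih =>
    have h : Γ.integral (fun w => w ^ (n + 1) * (w - ξ)⁻¹) =
        Γ.integral (fun w => ξ * (w ^ n * (w - ξ)⁻¹) + w ^ n) := by
      refine CurveFamily.integral_congr hΓ.mem fun w hw => ?_
      have h2 : w - ξ ≠ 0 := sub_ne_zero.2 fun h => hξK (h ▸ hw)
      field_simp
      ring
    rw [h, CurveFamily.integral_add hΓ.isCompact hΓ.mem, CurveFamily.integral_const_mul, ih,
      CurveFamily.integral_pow hΓ.mem]
    · ring
    · exact continuousOn_const.mul ((continuousOn_pow n).fun_mul hc)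
    · exact continuousOn_pow n

theorem cauchyFormula_polynomial (hΓ : Γ.Separates K S E 0) (P : Polynomial ℂ) :
    CauchyFormula Γ K E fun w => P.eval w := by
  induction P using Polynomial.induction_on' with
  | add P Q hP hQ =>
    simp only [Polynomial.eval_add]
    exact hΓ.cauchyFormula_add hP hQ
  | monomial n a =>
    simp only [Polynomial.eval_monomial]
    exact cauchyFormula_smul a (hΓ.cauchyFormula_pow n)

/-- Division with remainder isolates a polynomial part, which is harmless for `κ = 0` and absent
when `h` vanishes at `∞`. -/
theorem cauchyFormula_ratVal (hΓ : Γ.Separates K S E κ) {h : RatFunc ℂ}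
    (hroots : ∀ z, h.denom.IsRoot z → z ∈ S) (hκ : κ = 0 ∨ h.num.degree < h.denom.degree) :
    CauchyFormula Γ K E (ratVal h) := by
  have hval : ratVal h = fun z => h.num.eval z / h.denom.eval z := by
    ext z
    simp [ratVal, RatFunc.eval, Polynomial.eval₂_eq_eval_map]
  have hd0 := h.denom_ne_zero
  rw [hval]
  rcases hκ with rfl | hdeg
  · have h1 := hΓ.cauchyFormula_of_principalSum (PrincipalSum.eval_div_eval hd0
      (Polynomial.degree_modByMonic_lt h.num h.monic_denom) hroots)
    have h2 := hΓ.cauchyFormula_polynomial (h.num /ₘ h.denom)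
    refine hΓ.cauchyFormula_congr (hΓ.cauchyFormula_add h1 h2) fun w hw => ?_
    have hw' : h.denom.eval w ≠ 0 := fun hz => hw (hroots w hz)
    have hev := congrArg (Polynomial.eval w) (h.num.modByMonic_add_div h.denom)
    simp only [Polynomial.eval_add, Polynomial.eval_mul] at hev
    simp only [← hev]
    field_simp
  · exact hΓ.cauchyFormula_of_principalSum (PrincipalSum.eval_div_eval hd0 hdeg hroots)

end CurveFamily.Separates

end

/-! ### Integrability of Cauchy kernels in the plane -/

/-- In polar coordinates the Jacobian cancels the singularity and leaves `1 / (1 + r²)`. This is the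
basic majorant for the kernels below. -/
theorem integrable_inv_norm_mul_one_add_sq :
    Integrable fun z : ℂ => (‖z‖ * (1 + ‖z‖ ^ 2))⁻¹ := by
  rw [integrable_fun_norm_addHaar (E := ℂ) (μ := volume)
    (f := fun y : ℝ => (y * (1 + y ^ 2))⁻¹)]
  refine (integrable_inv_one_add_sq.integrableOn (s := Set.Ioi 0)).congr_fun (fun y hy => ?_)
    measurableSet_Ioi
  have hy' : y ≠ 0 := (Set.mem_Ioi.1 hy).ne'
  simp only [Complex.finrank_real_complex, smul_eq_mul]
  norm_num
  field_simp

/-- Allows the singularity and the decaying weight to have different centres, at the cost of a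
constant. -/
theorem one_add_norm_sub_sq_le (z a : ℂ) :
    1 + ‖z - a‖ ^ 2 ≤ 2 * (1 + ‖a‖ ^ 2) * (1 + ‖z‖ ^ 2) := by
  have h := norm_sub_le z a
  have h2 : ‖z - a‖ ^ 2 ≤ (‖z‖ + ‖a‖) ^ 2 := by gcongr
  nlinarith [sq_nonneg (‖z‖ - ‖a‖), sq_nonneg (‖z‖ * ‖a‖)]

theorem integrable_inv_norm_sub_mul_one_add_sq (a : ℂ) :
    Integrable fun z : ℂ => (‖z - a‖ * (1 + ‖z‖ ^ 2))⁻¹ := by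
  refine ((integrable_inv_norm_mul_one_add_sq.comp_sub_right a).const_mul
    (2 * (1 + ‖a‖ ^ 2))).mono' (by fun_prop) (Filter.Eventually.of_forall fun z => ?_)
  rw [Real.norm_of_nonneg (by positivity)]
  rcases eq_or_ne z a with rfl | hz
  · simp
  have hz' : 0 < ‖z - a‖ := norm_pos_iff.2 (sub_ne_zero.2 hz)
  have h := one_add_norm_sub_sq_le z a
  rw [← div_eq_mul_inv, inv_eq_one_div, div_le_div_iff₀ (by positivity) (by positivity)]
  calc 1 * (‖z - a‖ * (1 + ‖z - a‖ ^ 2))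
      ≤ ‖z - a‖ * (2 * (1 + ‖a‖ ^ 2) * (1 + ‖z‖ ^ 2)) := by rw [one_mul]; gcongr
    _ = _ := by ring

theorem measurable_rho0 : Measurable rho0 := by unfold rho0; fun_prop

theorem rho0_nonneg (w : ℂ) : 0 ≤ rho0 w := by unfold rho0; positivity

theorem rho0_le_of_le_norm {δ : ℝ} (hδ : 0 < δ) {w : ℂ} (hw : δ ≤ ‖w‖) :
    rho0 w ≤ (1 + (δ ^ 2)⁻¹) * (1 + ‖w‖ ^ 2)⁻¹ := by
  have hw0 : 0 < ‖w‖ := hδ.trans_le hw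
  unfold rho0
  rw [← div_eq_mul_inv, inv_eq_one_div, div_le_div_iff₀ (by positivity) (by positivity), one_mul,
    add_mul, one_mul, add_comm]
  gcongr
  rw [inv_mul_eq_div, one_le_div (by positivity)]
  gcongr

/-! ### The test functions -/

/-- The function `w ↦ w / (w - ξ) - w / (w - ξ')`, extended by `0` to `∞`. -/
def testFun (ξ ξ' : ℂ) : OnePoint ℂ → ℂ
  | Option.none => 0
  | Option.some w => ξ * (w - ξ)⁻¹ - ξ' * (w - ξ')⁻¹

theorem testFun_coe (ξ ξ' w : ℂ) :
    testFun ξ ξ' (w : OnePoint ℂ) = ξ * (w - ξ)⁻¹ - ξ' * (w - ξ')⁻¹ := rfl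

theorem testFun_infty (ξ ξ' : ℂ) : testFun ξ ξ' OnePoint.infty = 0 := rfl

theorem measurable_testFun_mul_rho0 (ξ ξ' : ℂ) :
    Measurable fun w : ℂ => testFun ξ ξ' w * (rho0 w : ℂ) := by
  simp only [testFun_coe]
  have := measurable_rho0
  fun_prop

theorem integrable_testFun_mul_rho0 {ξ ξ' : ℂ} (hξ : ξ ≠ 0) (hξ' : ξ' ≠ 0) :
    Integrable fun w : ℂ => testFun ξ ξ' w * (rho0 w : ℂ) := by
  have hI := (((integrable_inv_norm_sub_mul_one_add_sq ξ).const_mul (‖ξ‖ + ‖ξ‖⁻¹)).add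
    ((integrable_inv_norm_sub_mul_one_add_sq ξ').const_mul (‖ξ'‖ + ‖ξ'‖⁻¹))).add
    (integrable_inv_norm_mul_one_add_sq.const_mul (‖ξ‖⁻¹ + ‖ξ'‖⁻¹))
  refine hI.mono' (measurable_testFun_mul_rho0 ξ ξ').aestronglyMeasurable ?_
  have hne (a : ℂ) : ∀ᵐ w : ℂ, w ≠ a := by simp [ae_iff]
  filter_upwards [hne 0, hne ξ, hne ξ'] with w h0 h1 h2
  have h1' : w - ξ ≠ 0 := sub_ne_zero.2 h1
  have h2' : w - ξ' ≠ 0 := sub_ne_zero.2 h2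
  set F : ℂ := testFun ξ ξ' w with hF
  have b1 : ‖F‖ ≤ ‖ξ‖ * ‖w - ξ‖⁻¹ + ‖ξ'‖ * ‖w - ξ'‖⁻¹ := by
    rw [hF, testFun_coe]
    refine (norm_sub_le _ _).trans_eq ?_
    simp
  have b2 : ‖F‖ * rho0 w ≤ ‖ξ‖⁻¹ * (‖w - ξ‖⁻¹ + ‖w‖⁻¹) + ‖ξ'‖⁻¹ * (‖w - ξ'‖⁻¹ + ‖w‖⁻¹) := by
    -- The terms `1 / w²` of the two kernels cancel, which leaves only singularities of order one.
    have : F / w ^ 2 = ξ⁻¹ * ((w - ξ)⁻¹ - w⁻¹) - ξ'⁻¹ * ((w - ξ')⁻¹ - w⁻¹) := by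
      rw [hF, testFun_coe]
      field_simp
      ring
    have hn : ‖F‖ * rho0 w = ‖F / w ^ 2‖ := by
      rw [norm_div, norm_pow, rho0, div_eq_mul_inv]
    rw [hn, this]
    refine (norm_sub_le _ _).trans ?_
    rw [norm_mul, norm_mul, norm_inv, norm_inv]
    gcongr <;> refine (norm_sub_le _ _).trans_eq ?_ <;> simp
  rw [norm_mul, Complex.norm_real, Real.norm_of_nonneg (rho0_nonneg w)]
  have hw : 0 < ‖w‖ := norm_pos_iff.2 h0
  -- Since `ρ₀ = (1 + ρ₀) / (1 + |w|²)`, the bounds on `|F|` and on `|F| ρ₀` both acquire the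
  -- decaying weight.
  have hsplit : ‖F‖ * rho0 w = (‖F‖ + ‖F‖ * rho0 w) * (1 + ‖w‖ ^ 2)⁻¹ := by
    unfold rho0
    field_simp
    ring
  rw [hsplit]
  calc (‖F‖ + ‖F‖ * rho0 w) * (1 + ‖w‖ ^ 2)⁻¹
      ≤ ((‖ξ‖ * ‖w - ξ‖⁻¹ + ‖ξ'‖ * ‖w - ξ'‖⁻¹) +
        (‖ξ‖⁻¹ * (‖w - ξ‖⁻¹ + ‖w‖⁻¹) + ‖ξ'‖⁻¹ * (‖w - ξ'‖⁻¹ + ‖w‖⁻¹))) * (1 + ‖w‖ ^ 2)⁻¹ := by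
        gcongr
    _ = _ := by
        simp only [Pi.add_apply, mul_inv]
        ring

/-! ### The integral of a test function over the plane -/

/-- As `dz = i z dθ` on the circle, this is a winding number integral about `ξ`; periodicity shifts
the interval of angles. -/
theorem integral_circleMap_div_sub {r : ℝ} (hr : 0 < r) {ξ : ℂ} (hξ : ‖ξ‖ ≠ r) :
    ∫ θ in Set.Ioo (-Real.pi) Real.pi,
        (circleMap 0 r θ) * (circleMap 0 r θ - ξ)⁻¹ =
      if ‖ξ‖ < r then 2 * (Real.pi : ℂ) else 0 := by
  have hper : Function.Periodic
      (fun θ => (circleMap 0 r θ) * (circleMap 0 r θ - ξ)⁻¹) (2 * Real.pi) := by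
    intro θ
    simp only [periodic_circleMap 0 r θ]
  have h1 : ∫ θ in Set.Ioo (-Real.pi) Real.pi, (circleMap 0 r θ) * (circleMap 0 r θ - ξ)⁻¹ =
      ∫ θ in (0 : ℝ)..2 * Real.pi, (circleMap 0 r θ) * (circleMap 0 r θ - ξ)⁻¹ := by
    rw [← integral_Ioc_eq_integral_Ioo,
      ← intervalIntegral.integral_of_le (by linarith [Real.pi_pos])]
    have := hper.intervalIntegral_add_eq (-Real.pi) 0
    rw [show -Real.pi + 2 * Real.pi = Real.pi by ring, zero_add] at this
    exact this
  have h2 : (∮ z in C(0, r), (z - ξ)⁻¹) =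
      Complex.I * ∫ θ in (0 : ℝ)..2 * Real.pi, (circleMap 0 r θ) * (circleMap 0 r θ - ξ)⁻¹ := by
    rw [circleIntegral, ← intervalIntegral.integral_const_mul]
    congr 1 with θ
    simp only [deriv_circleMap, smul_eq_mul]
    ring
  have h3 : (∮ z in C(0, r), (z - ξ)⁻¹) = if ‖ξ‖ < r then 2 * Real.pi * Complex.I else 0 := by
    split_ifs with h
    · exact circleIntegral.integral_sub_inv_of_mem_ball (by simpa using h)
    · have hlt : r < ‖ξ‖ := lt_of_le_of_ne (not_lt.1 h) hξ.symm
      refine DiffContOnCl.circleIntegral_eq_zero hr.le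
        (DifferentiableOn.diffContOnCl fun z hz => ?_)
      have hz' : ‖z‖ ≤ r := by
        simpa using Metric.closure_ball_subset_closedBall hz
      have : z - ξ ≠ 0 := sub_ne_zero.2 fun h => absurd hz' (by rw [h]; exact not_le.2 hlt)
      exact (((differentiableAt_id).sub_const ξ).inv this).differentiableWithinAt
  rw [h1]
  apply mul_left_cancel₀ Complex.I_ne_zero
  rw [← h2, h3]
  split_ifs <;> ring

theorem integral_Ioi_indicator_sub_mul_inv {a b : ℝ} (ha : 0 < a) (hb : 0 < b) :
    ∫ r in Set.Ioi (0 : ℝ), (((if a < r then 1 else 0) - (if b < r then 1 else 0)) * r⁻¹ : ℝ) =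
      Real.log b - Real.log a := by
  have key {a b : ℝ} (ha : 0 < a) (hb : 0 < b) (hab : a ≤ b) :
      ∫ r in Set.Ioi (0 : ℝ), (((if a < r then 1 else 0) - (if b < r then 1 else 0)) * r⁻¹ : ℝ) =
        Real.log b - Real.log a := by
    have : (fun r : ℝ => (((if a < r then 1 else 0) - (if b < r then 1 else 0)) * r⁻¹ : ℝ)) =
        (Set.Ioc a b).indicator fun r => r⁻¹ := by
      ext r
      simp only [Set.indicator, Set.mem_Ioc]
      by_cases h1 : a < r <;> by_cases h2 : b < r
      · simp [h1, h2]
      · simp [h1, h2, not_lt.1 h2]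
      · exact absurd (hab.trans_lt h2) h1
      · simp [h1, h2]
    rw [this, setIntegral_indicator measurableSet_Ioc, Set.inter_eq_right.2
      (fun r (hr : r ∈ Set.Ioc a b) => (Set.mem_Ioi.2 (ha.trans hr.1))), ← intervalIntegral.integral_of_le hab,
      integral_inv_of_pos ha hb, Real.log_div hb.ne' ha.ne']
  rcases le_total a b with hab | hab
  · exact key ha hb hab
  · have := key hb ha hab
    rw [← neg_sub (Real.log a), ← this, ← integral_neg]
    congr 1 with r
    ring

theorem integrableOn_polarCoord_symm {g : ℂ → ℂ} (hg : Integrable g) (hm : Measurable g) :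
    IntegrableOn (fun p : ℝ × ℝ => p.1 • g (Complex.polarCoord.symm p)) polarCoord.target := by
  have hms : Measurable fun p : ℝ × ℝ => Complex.polarCoord.symm p := by
    simp only [Complex.polarCoord_symm_apply]
    fun_prop
  refine ⟨(measurable_fst.smul (hm.comp hms)).aestronglyMeasurable, ?_⟩
  rw [HasFiniteIntegral]
  have h := Complex.lintegral_comp_polarCoord_symm fun z => ‖g z‖ₑ
  have h2 : ∫⁻ p in polarCoord.target, ‖p.1 • g (Complex.polarCoord.symm p)‖ₑ =
      ∫⁻ p in polarCoord.target, ENNReal.ofReal p.1 • ‖g (Complex.polarCoord.symm p)‖ₑ := by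
    refine setLIntegral_congr_fun polarCoord.open_target.measurableSet fun p hp => ?_
    simp only [enorm_smul, smul_eq_mul]
    rw [Real.enorm_of_nonneg (le_of_lt hp.1)]
  rw [h2, h]
  exact hg.2

/-- The test function is also `w / (w - ξ) - w / (w - ξ')`, whose angular integral is a difference
of indicators of `|ξ| < r` and `|ξ'| < r`. The Jacobian times `ρ₀` is `1 / r`, whence the
logarithms. -/
theorem integral_testFun_mul_rho0 {ξ ξ' : ℂ} (hξ : ξ ≠ 0) (hξ' : ξ' ≠ 0) :
    ∫ w : ℂ, testFun ξ ξ' w * (rho0 w : ℂ) =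
      2 * Real.pi * ((Real.log ‖ξ'‖ - Real.log ‖ξ‖ : ℝ) : ℂ) := by
  have hint := integrableOn_polarCoord_symm (integrable_testFun_mul_rho0 hξ hξ')
    (measurable_testFun_mul_rho0 ξ ξ')
  rw [← Complex.integral_comp_polarCoord_symm]
  rw [polarCoord_target] at hint ⊢
  rw [Measure.volume_eq_prod] at hint ⊢
  rw [setIntegral_prod _ hint, ← integral_Ioi_indicator_sub_mul_inv (norm_pos_iff.2 hξ)
    (norm_pos_iff.2 hξ'), ← integral_complex_ofReal, ← MeasureTheory.integral_const_mul]
  refine setIntegral_congr_ae measurableSet_Ioi ?_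
  have hne (a : ℝ) : ∀ᵐ r : ℝ, r ≠ a := by simp [ae_iff]
  filter_upwards [hne ‖ξ‖, hne ‖ξ'‖] with r h1 h2 hr
  have hr0 : 0 < r := hr
  have hcirc (θ : ℝ) : Complex.polarCoord.symm (r, θ) = circleMap 0 r θ := by
    simp [circleMap, Complex.exp_mul_I]
  have hcont (a : ℂ) (ha : r ≠ ‖a‖) :
      Continuous fun θ => circleMap 0 r θ * (circleMap 0 r θ - a)⁻¹ := by
    refine (continuous_circleMap 0 r).mul
      (((continuous_circleMap 0 r).sub continuous_const).inv₀ fun θ => ?_)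
    refine sub_ne_zero.2 fun h => ha ?_
    rw [← show circleMap 0 r θ = a from h]
    simp [abs_of_pos hr0]
  have hI (a : ℂ) (ha : r ≠ ‖a‖) : IntegrableOn
      (fun θ => circleMap 0 r θ * (circleMap 0 r θ - a)⁻¹) (Set.Ioo (-Real.pi) Real.pi) :=
    ((hcont a ha).integrableOn_Icc).mono_set Set.Ioo_subset_Icc_self
  have hfun (θ : ℝ) : r • (testFun ξ ξ' (Complex.polarCoord.symm (r, θ)) *
      (rho0 (Complex.polarCoord.symm (r, θ)) : ℂ)) =
      (r : ℂ)⁻¹ * (circleMap 0 r θ * (circleMap 0 r θ - ξ)⁻¹ -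
        circleMap 0 r θ * (circleMap 0 r θ - ξ')⁻¹) := by
    have hn : ‖circleMap 0 r θ‖ = r := by simp [abs_of_pos hr0]
    have e1 : circleMap 0 r θ - ξ ≠ 0 := sub_ne_zero.2 fun h => h1 (by rw [← h, hn])
    have e2 : circleMap 0 r θ - ξ' ≠ 0 := sub_ne_zero.2 fun h => h2 (by rw [← h, hn])
    have hrc : (r : ℂ) ≠ 0 := by exact_mod_cast hr0.ne'
    rw [hcirc, testFun_coe, rho0, hn, Complex.real_smul]
    push_cast
    field_simp
    ring
  simp only [hfun]
  rw [MeasureTheory.integral_const_mul, integral_sub (hI ξ h1) (hI ξ' h2),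
    integral_circleMap_div_sub hr0 h1.symm, integral_circleMap_div_sub hr0 h2.symm]
  push_cast
  split_ifs <;> simp <;> ring

/-! ### Regularity of the weighted Cauchy transform of a plane set -/

theorem volume_eq_zero_of_hausdorffMeasure_one_lt_top {s : Set ℂ}
    (hs : Measure.hausdorffMeasure 1 s < ⊤) : volume s = 0 := by
  have h2 : Measure.hausdorffMeasure 2 s = 0 :=
    (Measure.hausdorffMeasure_zero_or_top (show (1 : ℝ) < 2 by norm_num) s).resolve_right hs.ne
  have hH : (Measure.hausdorffMeasure (Module.finrank ℝ ℂ) : Measure ℂ) =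
      Measure.hausdorffMeasure 2 := by
    rw [Complex.finrank_real_complex]
    norm_num
  have : (volume : Measure ℂ) ≪ Measure.hausdorffMeasure (Module.finrank ℝ ℂ) :=
    Measure.absolutelyContinuous_isAddHaarMeasure _ _
  exact this (by rw [hH]; exact h2)

/-- The Cauchy transform of `E`, without the normalization of area. -/
def planeCauchy (E : Set ℂ) (w : ℂ) : ℂ := ∫ ξ in E, (rho0 ξ : ℂ) / (w - ξ)

section

variable {E : Set ℂ} {δ : ℝ}

theorem norm_kernel_le (hδ : 0 < δ) {ξ : ℂ} (hξ : δ ≤ ‖ξ‖) (w : ℂ) :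
    ‖(rho0 ξ : ℂ) / (w - ξ)‖ ≤ (1 + (δ ^ 2)⁻¹) * (‖ξ - w‖ * (1 + ‖ξ‖ ^ 2))⁻¹ := by
  rw [norm_div, Complex.norm_real, Real.norm_of_nonneg (rho0_nonneg ξ), norm_sub_rev,
    mul_inv, div_eq_mul_inv]
  calc rho0 ξ * ‖ξ - w‖⁻¹ ≤ ((1 + (δ ^ 2)⁻¹) * (1 + ‖ξ‖ ^ 2)⁻¹) * ‖ξ - w‖⁻¹ := by
        gcongr
        exact rho0_le_of_le_norm hδ hξ
    _ = _ := by ring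

theorem measurable_kernel (w : ℂ) : Measurable fun ξ : ℂ => (rho0 ξ : ℂ) / (w - ξ) := by
  have := measurable_rho0
  fun_prop

theorem integrableOn_kernel (hE : IsOpen E) (hδ : 0 < δ) (hEδ : ∀ ξ ∈ E, δ ≤ ‖ξ‖) (w : ℂ) :
    IntegrableOn (fun ξ : ℂ => (rho0 ξ : ℂ) / (w - ξ)) E := by
  refine (((integrable_inv_norm_sub_mul_one_add_sq w).const_mul (1 + (δ ^ 2)⁻¹)).integrableOn).mono'
    (measurable_kernel w).aestronglyMeasurable ?_
  exact (ae_restrict_iff' hE.measurableSet).2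
    (Filter.Eventually.of_forall fun ξ hξ => norm_kernel_le hδ (hEδ ξ hξ) w)

/-- The substitution fixes the singularity at `z = 0` and moves the dependence on `w` into the
bounded density. -/
theorem planeCauchy_eq_integral_sub (hE : IsOpen E) (w : ℂ) :
    planeCauchy E w = ∫ z : ℂ, E.indicator (fun ξ => (rho0 ξ : ℂ)) (w - z) / z := by
  rw [planeCauchy, ← integral_indicator hE.measurableSet, ← integral_sub_left_eq_self _ _ w]
  congr 1 with z
  simp only [Set.indicator]
  split_ifs <;> simp

theorem continuous_planeCauchy (hE : IsOpen E) (hδ : 0 < δ) (hEδ : ∀ ξ ∈ E, δ ≤ ‖ξ‖)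
    (hfr : volume (frontier E) = 0) : Continuous (planeCauchy E) := by
  have hfun : planeCauchy E =
      fun w => ∫ z : ℂ, E.indicator (fun ξ => (rho0 ξ : ℂ)) (w - z) / z :=
    funext (planeCauchy_eq_integral_sub hE)
  rw [hfun, continuous_iff_continuousAt]
  intro w₀
  have hmeas : Measurable (E.indicator fun ξ => (rho0 ξ : ℂ)) :=
    (Complex.measurable_ofReal.comp measurable_rho0).indicator hE.measurableSet
  -- The constant comes from `one_add_norm_sub_sq_le` with `‖w‖ ≤ ‖w₀‖ + 1`.
  refine continuousAt_of_dominated (bound := fun z =>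
    ((1 + (δ ^ 2)⁻¹) * (2 * (1 + (‖w₀‖ + 1) ^ 2))) * (‖z‖ * (1 + ‖z‖ ^ 2))⁻¹) ?_ ?_
    (integrable_inv_norm_mul_one_add_sq.const_mul _) ?_
  · exact Filter.Eventually.of_forall fun w =>
      ((hmeas.comp (measurable_const.sub measurable_id)).div measurable_id).aestronglyMeasurable
  · filter_upwards [Metric.ball_mem_nhds w₀ one_pos] with w hw
    refine Filter.Eventually.of_forall fun z => ?_
    have hw' : ‖w‖ ≤ ‖w₀‖ + 1 := by
      have h1 : ‖w - w₀‖ < 1 := by simpa [dist_eq_norm] using hw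
      have h2 := norm_add_le (w - w₀) w₀
      rw [sub_add_cancel] at h2
      linarith
    rw [norm_div]
    have hind : ‖E.indicator (fun ξ => (rho0 ξ : ℂ)) (w - z)‖ ≤
        (1 + (δ ^ 2)⁻¹) * (1 + ‖w - z‖ ^ 2)⁻¹ := by
      by_cases h : w - z ∈ E
      · rw [Set.indicator_of_mem h, Complex.norm_real, Real.norm_of_nonneg (rho0_nonneg _)]
        exact rho0_le_of_le_norm hδ (hEδ _ h)
      · rw [Set.indicator_of_notMem h, norm_zero]
        positivity
    have hz : (1 + ‖w - z‖ ^ 2)⁻¹ ≤ (2 * (1 + (‖w₀‖ + 1) ^ 2)) * (1 + ‖z‖ ^ 2)⁻¹ := by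
      have h := one_add_norm_sub_sq_le (w - z) w
      rw [show w - z - w = -z by ring, norm_neg] at h
      rw [← div_eq_mul_inv, inv_eq_one_div, div_le_div_iff₀ (by positivity) (by positivity),
        one_mul]
      refine h.trans ?_
      gcongr
    calc ‖E.indicator (fun ξ => (rho0 ξ : ℂ)) (w - z)‖ / ‖z‖
        ≤ ((1 + (δ ^ 2)⁻¹) * ((2 * (1 + (‖w₀‖ + 1) ^ 2)) * (1 + ‖z‖ ^ 2)⁻¹)) / ‖z‖ := by
          gcongr
          refine hind.trans ?_
          gcongr
      _ = _ := by
          rw [mul_inv]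
          ring
  · have hae : ∀ᵐ z : ℂ, w₀ - z ∉ frontier E :=
      (quasiMeasurePreserving_sub_left_of_right_invariant volume w₀).ae
        (measure_eq_zero_iff_ae_notMem.1 hfr)
    filter_upwards [hae] with z hz
    have hc : ContinuousOn (fun ξ => (rho0 ξ : ℂ)) (interior E) := by
      refine Complex.continuous_ofReal.comp_continuousOn ?_
      refine ContinuousOn.inv₀ (by fun_prop) fun ξ hξ => ?_
      have : 0 < ‖ξ‖ := hδ.trans_le (hEδ ξ (interior_subset hξ))
      positivity
    have h1 := hc.continuousAt_indicator hz
    exact (ContinuousAt.comp (f := fun w => w - z) h1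
      (by fun_prop : ContinuousAt (fun w : ℂ => w - z) w₀)).div_const z

/-- Differentiation under the integral sign. For `x` within half the distance bound `η`, `|x - ξ| ≥
|w₀ - ξ| / 2`, so the derivative of the kernel is at most `4 / η` times the kernel at `w₀`. -/
theorem differentiableAt_planeCauchy (hE : IsOpen E) (hδ : 0 < δ) (hEδ : ∀ ξ ∈ E, δ ≤ ‖ξ‖)
    {w₀ : ℂ} (hw₀ : w₀ ∉ closure E) : DifferentiableAt ℂ (planeCauchy E) w₀ := by
  obtain ⟨η, hη, hball⟩ := Metric.isOpen_iff.1 isClosed_closure.isOpen_compl w₀ hw₀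
  have hdist (ξ : ℂ) (hξ : ξ ∈ E) : η ≤ ‖w₀ - ξ‖ := by
    by_contra! h
    exact hball (Metric.mem_ball'.2 (by rwa [dist_eq_norm])) (subset_closure hξ)
  have hlow (ξ : ℂ) (hξ : ξ ∈ E) (x : ℂ) (hx : x ∈ Metric.ball w₀ (η / 2)) :
      ‖w₀ - ξ‖ / 2 ≤ ‖x - ξ‖ := by
    have h1 : ‖w₀ - x‖ < η / 2 := by simpa [dist_eq_norm, norm_sub_rev] using hx
    have h2 := norm_add_le (w₀ - x) (x - ξ)
    rw [sub_add_sub_cancel] at h2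
    linarith [hdist ξ hξ]
  have hne (ξ : ℂ) (hξ : ξ ∈ E) (x : ℂ) (hx : x ∈ Metric.ball w₀ (η / 2)) : x - ξ ≠ 0 :=
    norm_pos_iff.1 (lt_of_lt_of_le (by linarith [hdist ξ hξ]) (hlow ξ hξ x hx))
  refine (hasDerivAt_integral_of_dominated_loc_of_deriv_le (μ := volume.restrict E)
    (F := fun w ξ => (rho0 ξ : ℂ) / (w - ξ)) (F' := fun w ξ => -(rho0 ξ : ℂ) / (w - ξ) ^ 2)
    (bound := fun ξ => (4 / η) * ‖(rho0 ξ : ℂ) / (w₀ - ξ)‖)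
    (Metric.ball_mem_nhds w₀ (half_pos hη)) ?_ (integrableOn_kernel hE hδ hEδ w₀) ?_ ?_
    ((integrableOn_kernel hE hδ hEδ w₀).norm.const_mul _) ?_).2.differentiableAt
  · exact Filter.Eventually.of_forall fun w => (measurable_kernel w).aestronglyMeasurable
  · have := measurable_rho0
    exact Measurable.aestronglyMeasurable (by fun_prop)
  · refine (ae_restrict_iff' hE.measurableSet).2 (Filter.Eventually.of_forall fun ξ hξ x hx => ?_)
    have h0 := hdist ξ hξ
    have h1 := hlow ξ hξ x hx
    have h2 : 0 < ‖w₀ - ξ‖ := hη.trans_le h0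
    rw [norm_div, norm_div, norm_neg, norm_pow]
    calc ‖(rho0 ξ : ℂ)‖ / ‖x - ξ‖ ^ 2 ≤ ‖(rho0 ξ : ℂ)‖ / (‖w₀ - ξ‖ / 2) ^ 2 := by gcongr
      _ = (4 / ‖w₀ - ξ‖) * (‖(rho0 ξ : ℂ)‖ / ‖w₀ - ξ‖) := by field_simp; norm_num
      _ ≤ _ := by gcongr
  · refine (ae_restrict_iff' hE.measurableSet).2 (Filter.Eventually.of_forall fun ξ hξ x hx => ?_)
    have h := ((hasDerivAt_const x (rho0 ξ : ℂ)).fun_div ((hasDerivAt_id x).sub_const ξ)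
      (hne ξ hξ x hx))
    simpa using h

theorem tendsto_planeCauchy_cobounded (hδ : 0 < δ) (hEδ : ∀ ξ ∈ E, δ ≤ ‖ξ‖)
    (hb : Bornology.IsBounded E) :
    Filter.Tendsto (planeCauchy E) (Bornology.cobounded ℂ) (nhds 0) := by
  obtain ⟨M, hM⟩ := hb.exists_norm_le
  have hlim : Filter.Tendsto
      (fun w : ℂ => (δ ^ 2)⁻¹ / (‖w‖ - M) * (volume E).toReal) (Bornology.cobounded ℂ) (nhds 0) := by
    have h1 : Filter.Tendsto (fun w : ℂ => ‖w‖ - M) (Bornology.cobounded ℂ) Filter.atTop :=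
      Filter.tendsto_atTop_add_const_right _ _ tendsto_norm_cobounded_atTop
    simpa using (h1.const_div_atTop (δ ^ 2)⁻¹).mul_const (volume E).toReal
  refine squeeze_zero_norm' ?_ hlim
  filter_upwards [tendsto_norm_cobounded_atTop.eventually_gt_atTop M] with w hw
  refine norm_setIntegral_le_of_norm_le_const hb.measure_lt_top fun ξ hξ => ?_
  have h1 : ‖w‖ - M ≤ ‖w - ξ‖ := by
    have := norm_sub_norm_le w ξ
    linarith [hM ξ hξ]
  have h2 : 0 < ‖w‖ - M := sub_pos.2 hw
  rw [norm_div, Complex.norm_real, Real.norm_of_nonneg (rho0_nonneg ξ)]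
  have h3 : rho0 ξ ≤ (δ ^ 2)⁻¹ := by
    unfold rho0
    have := hEδ ξ hξ
    gcongr
  gcongr

end

/-! ### The charts of the sphere at infinity -/

/-- The inverse `ζ ↦ a + 1 / ζ` of the coordinate `z ↦ 1 / (z - a)` of the sphere. -/
def invChart (a ζ : ℂ) : OnePoint ℂ :=
  if ζ = 0 then OnePoint.infty else ((a + ζ⁻¹ : ℂ) : OnePoint ℂ)

@[simp]
theorem invChart_zero (a : ℂ) : invChart a 0 = OnePoint.infty := by simp [invChart]

theorem invChart_of_ne_zero (a : ℂ) {ζ : ℂ} (hζ : ζ ≠ 0) :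
    invChart a ζ = ((a + ζ⁻¹ : ℂ) : OnePoint ℂ) := by simp [invChart, hζ]

theorem invChart_inv_sub {a w : ℂ} (h : w ≠ a) : invChart a (w - a)⁻¹ = (w : OnePoint ℂ) := by
  rw [invChart_of_ne_zero a (inv_ne_zero (sub_ne_zero.2 h)), inv_inv, add_sub_cancel]

theorem invChart_zero_left : invChart 0 = chartInfty := by
  ext ζ
  simp [invChart, chartInfty]

theorem invChart_eventuallyEq (a : ℂ) {ζ : ℂ} (hζ : ζ ≠ 0) :
    invChart a =ᶠ[nhds ζ] fun z => ((a + z⁻¹ : ℂ) : OnePoint ℂ) := by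
  filter_upwards [isOpen_ne.mem_nhds hζ] with z hz using invChart_of_ne_zero a hz

theorem tendsto_add_inv_cobounded (a : ℂ) :
    Filter.Tendsto (fun z : ℂ => a + z⁻¹) (nhdsWithin 0 {0}ᶜ) (Bornology.cobounded ℂ) := by
  have := Filter.tendsto_inv₀_nhdsNE_zero (α := ℂ)
  exact (tendsto_const_add_cobounded a).comp this

theorem continuous_invChart (a : ℂ) : Continuous (invChart a) := by
  rw [continuous_iff_continuousAt]
  intro ζ
  rcases eq_or_ne ζ 0 with rfl | hζ
  · rw [continuousAt_iff_punctured_nhds, invChart_zero]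
    have h : Filter.Tendsto (fun z : ℂ => ((a + z⁻¹ : ℂ) : OnePoint ℂ)) (nhdsWithin 0 {0}ᶜ)
        (nhds OnePoint.infty) := by
      refine OnePoint.tendsto_coe_infty.comp ?_
      rw [Filter.coclosedCompact_eq_cocompact, ← Metric.cobounded_eq_cocompact]
      exact tendsto_add_inv_cobounded a
    refine h.congr' ?_
    filter_upwards [self_mem_nhdsWithin] with z hz using (invChart_of_ne_zero a hz).symm
  · refine ContinuousAt.congr ?_ (invChart_eventuallyEq a hζ).symm
    exact (OnePoint.continuous_coe.continuousAt).comp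
      (continuousAt_const.add (continuousAt_inv₀ hζ))

theorem continuous_chartInfty : Continuous chartInfty := by
  rw [← invChart_zero_left]
  exact continuous_invChart 0

/-! ### Finite parts -/

theorem isOpen_finitePart {U : Set (OnePoint ℂ)} (hU : IsOpen U) : IsOpen (finitePart U) :=
  hU.preimage OnePoint.continuous_coe

theorem closure_finitePart (U : Set (OnePoint ℂ)) : closure (finitePart U) = finitePart (closure U) :=
  (OnePoint.isOpenEmbedding_coe.isOpenMap.preimage_closure_eq_closure_preimage
    OnePoint.continuous_coe U).symm

theorem isCompact_finitePart_compl {U : Set (OnePoint ℂ)} (hU : IsOpen U)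
    (h : OnePoint.infty ∈ U) : IsCompact (finitePart Uᶜ) :=
  ((OnePoint.isOpen_iff_of_mem h).1 hU).2

/-! ### The class `A(Ω)` -/

variable {Ω : Set (OnePoint ℂ)}

/-- At `∞` a limit suffices, because the isolated singularity in the coordinate `1 / z` is
removable. -/
theorem memA_of_tendsto {f : OnePoint ℂ → ℂ} (hΩ : IsOpen Ω) (hinf : OnePoint.infty ∉ frontier Ω)
    (hd : ∀ z : ℂ, (z : OnePoint ℂ) ∈ Ω → DifferentiableAt ℂ (fun z : ℂ => f z) z)
    (hc : ∀ z : ℂ, (z : OnePoint ℂ) ∈ closure Ω → ContinuousAt (fun z : ℂ => f z) z)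
    (hlim : OnePoint.infty ∈ Ω →
      Filter.Tendsto (fun z : ℂ => f z) (Bornology.cobounded ℂ) (nhds (f OnePoint.infty))) :
    MemA Ω f := by
  have hcinf : OnePoint.infty ∈ Ω → ContinuousAt f OnePoint.infty := fun h => by
    rw [OnePoint.continuousAt_infty', Filter.coclosedCompact_eq_cocompact,
      ← Metric.cobounded_eq_cocompact]
    exact hlim h
  have hdne (ζ : ℂ) (hζ : ζ ≠ 0) (h : chartInfty ζ ∈ Ω) :
      DifferentiableAt ℂ (fun ζ : ℂ => f (chartInfty ζ)) ζ := by
    rw [← invChart_zero_left, invChart_of_ne_zero 0 hζ] at h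
    have h1 : DifferentiableAt ℂ (fun z : ℂ => (0 : ℂ) + z⁻¹) ζ :=
      (differentiableAt_inv hζ).const_add 0
    have h2 := DifferentiableAt.comp ζ (hd _ h) h1
    refine h2.congr_of_eventuallyEq ?_
    filter_upwards [invChart_eventuallyEq 0 hζ] with z hz
    rw [← invChart_zero_left, hz]
    rfl
  refine ⟨⟨fun z hz => (hd z hz).differentiableWithinAt, ?_⟩, ?_⟩
  · by_cases h : OnePoint.infty ∈ Ω
    · have hopen : IsOpen (chartInfty ⁻¹' Ω) := hΩ.preimage continuous_chartInfty
      have h0 : chartInfty 0 = OnePoint.infty := by simp [chartInfty]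
      refine (Complex.differentiableOn_compl_singleton_and_continuousAt_iff (c := 0)
        (hopen.mem_nhds (by rw [Set.mem_preimage, h0]; exact h))).1 ⟨?_, ?_⟩
      · exact fun ζ hζ => (hdne ζ hζ.2 hζ.1).differentiableWithinAt
      · refine ContinuousAt.comp ?_ continuous_chartInfty.continuousAt
        rw [h0]
        exact hcinf h
    · intro ζ hζ
      have hζ0 : ζ ≠ 0 := by
        rintro rfl
        exact h (by simpa [chartInfty] using hζ)
      exact (hdne ζ hζ0 hζ).differentiableWithinAt
  · intro x hx
    induction x using OnePoint.rec with
    | infty =>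
      have : OnePoint.infty ∈ Ω := by
        by_contra h
        exact hinf (by rw [hΩ.frontier_eq]; exact ⟨hx, h⟩)
      exact (hcinf this).continuousWithinAt
    | coe z => exact (OnePoint.continuousAt_coe.2 (hc z hx)).continuousWithinAt

theorem MemA.sub {f g : OnePoint ℂ → ℂ} (hf : MemA Ω f) (hg : MemA Ω g) :
    MemA Ω fun x => f x - g x :=
  ⟨⟨hf.1.1.fun_sub hg.1.1, hf.1.2.fun_sub hg.1.2⟩, hf.2.fun_sub hg.2⟩

theorem MemA.differentiableOn_comp_invChart {D : OnePoint ℂ → ℂ} (hΩ : IsOpen Ω) (hD : MemA Ω D)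
    (a : ℂ) : DifferentiableOn ℂ (fun ζ => D (invChart a ζ)) (invChart a ⁻¹' Ω) := by
  intro ζ hζ
  refine DifferentiableAt.differentiableWithinAt ?_
  rcases eq_or_ne ζ 0 with rfl | hζ0
  · have hinf : OnePoint.infty ∈ Ω := by simpa using hζ
    have h0 : chartInfty 0 = OnePoint.infty := by simp [chartInfty]
    have h1 : DifferentiableAt ℂ (fun ζ : ℂ => D (chartInfty ζ)) 0 :=
      hD.1.2.differentiableAt ((hΩ.preimage continuous_chartInfty).mem_nhds
        (by rw [Set.mem_preimage, h0]; exact hinf))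
    -- The transition map from the coordinate `1 / (z - a)` to `1 / z`.
    have h2 : DifferentiableAt ℂ (fun ζ : ℂ => ζ / (1 + a * ζ)) 0 :=
      DifferentiableAt.fun_div (by fun_prop) (by fun_prop) (by simp)
    have h3 : DifferentiableAt ℂ (fun ζ : ℂ => D (chartInfty (ζ / (1 + a * ζ)))) 0 :=
      DifferentiableAt.comp (g := fun ζ : ℂ => D (chartInfty ζ)) (0 : ℂ) (by simpa using h1) h2
    refine h3.congr_of_eventuallyEq ?_
    have hne : ∀ᶠ ζ : ℂ in nhds 0, 1 + a * ζ ≠ 0 :=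
      (Continuous.continuousAt (by fun_prop)).eventually_ne (by simp)
    filter_upwards [hne] with z hz
    rcases eq_or_ne z 0 with rfl | hz0
    · simp [h0]
    · rw [invChart_of_ne_zero a hz0, chartInfty, if_neg (div_ne_zero hz0 hz)]
      congr 2
      field_simp
      ring
  · have hmem : (((a + ζ⁻¹ : ℂ)) : OnePoint ℂ) ∈ Ω := by
      rw [← invChart_of_ne_zero a hζ0]
      exact hζ
    have h1 : DifferentiableAt ℂ (fun z : ℂ => a + z⁻¹) ζ :=
      (differentiableAt_inv hζ0).const_add a
    have h2 := DifferentiableAt.comp ζ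
      (hD.1.1.differentiableAt ((isOpen_finitePart hΩ).mem_nhds hmem)) h1
    refine h2.congr_of_eventuallyEq ?_
    filter_upwards [invChart_eventuallyEq a hζ0] with z hz
    rw [hz]
    rfl

/-- Sending an exterior point to infinity makes the maximum principle available even if `∞ ∈ Ω`. -/
theorem isBounded_preimage_invChart {a : ℂ} (ha : (a : OnePoint ℂ) ∉ closure Ω) :
    Bornology.IsBounded (invChart a ⁻¹' Ω) := by
  have ha' : a ∈ (closure (finitePart Ω))ᶜ := by
    rw [closure_finitePart]
    exact ha
  obtain ⟨ε, hε, hball⟩ := Metric.isOpen_iff.1 isClosed_closure.isOpen_compl a ha'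
  refine isBounded_iff_forall_norm_le.2 ⟨ε⁻¹, fun ζ hζ => ?_⟩
  rcases eq_or_ne ζ 0 with rfl | hζ0
  · simpa using hε.le
  have hmem : a + ζ⁻¹ ∈ finitePart Ω := by
    change ((a + ζ⁻¹ : ℂ) : OnePoint ℂ) ∈ Ω
    rw [← invChart_of_ne_zero a hζ0]
    exact hζ
  have : ε ≤ ‖ζ‖⁻¹ := by
    by_contra! h
    exact hball (show a + ζ⁻¹ ∈ Metric.ball a ε by simpa [dist_eq_norm] using h)
      (subset_closure hmem)
  exact (le_inv_comm₀ (norm_pos_iff.2 hζ0) hε).2 this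

/-- A function of class `A(Ω)` that equals `c / w` on the boundary of a domain containing `0`
vanishes, and so does `c`. -/
theorem MemA.eqOn_zero_of_eq_div {D : OnePoint ℂ → ℂ} {a c : ℂ} (hΩ : IsOpen Ω)
    (hinf : OnePoint.infty ∉ frontier Ω) (h0 : ((0 : ℂ) : OnePoint ℂ) ∈ Ω)
    (ha : (a : OnePoint ℂ) ∉ closure Ω) (hD : MemA Ω D)
    (hfr : ∀ w : ℂ, (w : OnePoint ℂ) ∈ frontier Ω → D w = c / w) :
    c = 0 ∧ Set.EqOn D 0 (closure Ω) := by
  have ha0 : a ≠ 0 := by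
    rintro rfl
    exact ha (subset_closure h0)
  have hcl : closure (invChart a ⁻¹' Ω) ⊆ invChart a ⁻¹' closure Ω :=
    (continuous_invChart a).closure_preimage_subset Ω
  have hdc : DiffContOnCl ℂ (fun ζ => D (invChart a ζ)) (invChart a ⁻¹' Ω) :=
    ⟨hD.differentiableOn_comp_invChart hΩ a,
      hD.2.comp (continuous_invChart a).continuousOn hcl⟩
  have hfrU (ζ : ℂ) (hζ : ζ ∈ frontier (invChart a ⁻¹' Ω)) : ζ ≠ 0 ∧
      ((a + ζ⁻¹ : ℂ) : OnePoint ℂ) ∈ frontier Ω := by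
    have h1 := (continuous_invChart a).frontier_preimage_subset Ω hζ
    have hζ0 : ζ ≠ 0 := by
      rintro rfl
      exact hinf (by simpa using h1)
    exact ⟨hζ0, by rw [← invChart_of_ne_zero a hζ0]; exact h1⟩
  have hnotfr : ((0 : ℂ) : OnePoint ℂ) ∉ frontier Ω := by
    rw [hΩ.frontier_eq]
    exact fun h => h.2 h0
  have hbdd := isBounded_preimage_invChart ha
  have hc : c = 0 := by
    -- With `w = a + 1 / ζ` this is `ζ (w D - c)`: the factor `1 + a ζ = w ζ` clears the pole of `c
    -- / w` and stays regular at `ζ = 0`.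
    have hg : DiffContOnCl ℂ (fun ζ => D (invChart a ζ) * (1 + a * ζ) - c * ζ)
        (invChart a ⁻¹' Ω) := by
      have hl : DiffContOnCl ℂ (fun ζ : ℂ => 1 + a * ζ) (invChart a ⁻¹' Ω) :=
        Differentiable.diffContOnCl (by fun_prop)
      have hr : DiffContOnCl ℂ (fun ζ : ℂ => c * ζ) (invChart a ⁻¹' Ω) :=
        Differentiable.diffContOnCl (by fun_prop)
      exact ⟨(hdc.1.fun_mul hl.1).fun_sub hr.1, (hdc.2.fun_mul hl.2).fun_sub hr.2⟩
    have hz := Complex.eqOn_closure_of_eqOn_frontier hbdd hg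
      (diffContOnCl_const (c := (0 : ℂ))) fun ζ hζ => by
        obtain ⟨hζ0, hmem⟩ := hfrU ζ hζ
        have hw : a + ζ⁻¹ ≠ 0 := fun h => hnotfr (by rw [← h]; exact hmem)
        have hw' : 1 + a * ζ = (a + ζ⁻¹) * ζ := by
          field_simp
          ring
        rw [invChart_of_ne_zero a hζ0, hfr _ hmem, hw', ← mul_assoc, div_mul_cancel₀ _ hw, sub_self]
    have ha1 : -a⁻¹ ≠ 0 := neg_ne_zero.2 (inv_ne_zero ha0)
    -- The point `ζ = -1 / a` corresponds to `w = 0`, where the function reduces to `c / a`.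
    have hmem : -a⁻¹ ∈ invChart a ⁻¹' Ω := by
      rw [Set.mem_preimage, invChart_of_ne_zero a ha1, inv_neg, inv_inv, add_neg_cancel]
      exact h0
    have := hz (subset_closure hmem)
    simpa [ha0] using this
  subst hc
  have hfr0 (x : OnePoint ℂ) (hx : x ∈ frontier Ω) : D x = 0 := by
    induction x using OnePoint.rec with
    | infty => exact absurd hx hinf
    | coe z => simpa using hfr z hx
  have hz := Complex.eqOn_closure_of_eqOn_frontier hbdd hdc
    (diffContOnCl_const (c := (0 : ℂ))) fun ζ hζ =>
      hfr0 _ ((continuous_invChart a).frontier_preimage_subset Ω hζ)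
  refine ⟨rfl, fun x hx => ?_⟩
  by_cases hxΩ : x ∈ Ω
  · obtain ⟨ζ, rfl⟩ : ∃ ζ, invChart a ζ = x := by
      induction x using OnePoint.rec with
      | infty => exact ⟨0, invChart_zero a⟩
      | coe z =>
        refine ⟨_, invChart_inv_sub fun h => ha ?_⟩
        rw [← h]
        exact hx
    exact hz (subset_closure hxΩ)
  · exact hfr0 x (by rw [hΩ.frontier_eq]; exact ⟨hx, hxΩ⟩)

variable {Ω : Set (OnePoint ℂ)} {h : RatFunc ℂ}

/-! ### The exterior -/

theorem isOpen_sphereExt (Ω : Set (OnePoint ℂ)) : IsOpen (sphereExt Ω) :=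
  isClosed_closure.isOpen_compl

theorem IsLQD.frontier_eq (hΩ : IsLQD Ω h) : frontier Ω = closure Ω \ Ω :=
  hΩ.isOpen.frontier_eq

/-- The regularity `Ω = int (closure Ω)` makes every boundary point a limit of exterior points, so
identities on the exterior reach all of `∂Ω`. -/
theorem IsLQD.closure_sphereExt (hΩ : IsLQD Ω h) : closure (sphereExt Ω) = Ωᶜ := by
  rw [sphereExt, closure_compl, hΩ.interior_closure]

theorem IsLQD.frontier_finitePart_sphereExt (hΩ : IsLQD Ω h) :
    frontier (finitePart (sphereExt Ω)) = finitePart (frontier Ω) := by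
  rw [(isOpen_finitePart (isOpen_sphereExt Ω)).frontier_eq, closure_finitePart,
    hΩ.closure_sphereExt, hΩ.frontier_eq]
  ext z
  simp [finitePart, sphereExt, and_comm]

theorem IsLQD.volume_frontier (hΩ : IsLQD Ω h) :
    volume (frontier (finitePart (sphereExt Ω))) = 0 := by
  rw [hΩ.frontier_finitePart_sphereExt]
  exact volume_eq_zero_of_hausdorffMeasure_one_lt_top hΩ.rectifiable

theorem IsLQD.exists_le_norm (hΩ : IsLQD Ω h) (h0 : ((0 : ℂ) : OnePoint ℂ) ∈ Ω) :
    ∃ δ > 0, ∀ ξ ∈ finitePart (sphereExt Ω), δ ≤ ‖ξ‖ := by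
  obtain ⟨δ, hδ, hball⟩ := Metric.isOpen_iff.1 (isOpen_finitePart hΩ.isOpen) 0 h0
  refine ⟨δ, hδ, fun ξ hξ => ?_⟩
  by_contra! hlt
  exact hξ (subset_closure (hball (by simpa using hlt)))

theorem IsLQD.nonempty_finitePart_sphereExt (hΩ : IsLQD Ω h) (hne : Ω ≠ Set.univ) :
    (finitePart (sphereExt Ω)).Nonempty := by
  have hn : (sphereExt Ω).Nonempty := by
    rw [Set.nonempty_iff_ne_empty]
    intro he
    have : closure Ω = Set.univ := by simpa [sphereExt] using he
    exact hne (by rw [← hΩ.interior_closure, this, interior_univ])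
  obtain ⟨_, hz, z, rfl⟩ := OnePoint.denseRange_coe.inter_open_nonempty _ (isOpen_sphereExt Ω) hn
  exact ⟨z, hz⟩

theorem cauchyTransform_coe (w : ℂ) :
    cauchyTransform rho0 (sphereExt Ω) (w : OnePoint ℂ) =
      (Real.pi : ℂ)⁻¹ * planeCauchy (finitePart (sphereExt Ω)) w := rfl

theorem cauchyTransform_infty : cauchyTransform rho0 (sphereExt Ω) OnePoint.infty = 0 := by
  change (Real.pi : ℂ)⁻¹ * ∫ _ in finitePart (sphereExt Ω), (0 : ℂ) = 0
  simp

theorem IsLQD.memA_cauchyTransform (hΩ : IsLQD Ω h) (h0 : ((0 : ℂ) : OnePoint ℂ) ∈ Ω) :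
    MemA Ω (cauchyTransform rho0 (sphereExt Ω)) := by
  obtain ⟨δ, hδ, hEδ⟩ := hΩ.exists_le_norm h0
  have hE := isOpen_finitePart (isOpen_sphereExt Ω)
  refine memA_of_tendsto hΩ.isOpen hΩ.infty_notMem_frontier (fun z hz => ?_) (fun z _ => ?_)
    fun hinf => ?_
  · simp only [cauchyTransform_coe]
    refine (differentiableAt_planeCauchy hE hδ hEδ ?_).const_mul _
    rw [closure_finitePart, hΩ.closure_sphereExt]
    exact fun h => h hz
  · simp only [cauchyTransform_coe]
    exact continuousAt_const.mul
      (continuous_planeCauchy hE hδ hEδ hΩ.volume_frontier).continuousAt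
  · simp only [cauchyTransform_coe, cauchyTransform_infty]
    have hb : Bornology.IsBounded (finitePart (sphereExt Ω)) :=
      (isCompact_finitePart_compl hΩ.isOpen hinf).isBounded.subset
        fun z hz hz' => hz (subset_closure hz')
    simpa using (tendsto_planeCauchy_cobounded hδ hEδ hb).const_mul (Real.pi : ℂ)⁻¹

/-! ### The quadrature identity for the test functions -/

theorem IsLQD.memL1a_testFun (hΩ : IsLQD Ω h) (h0 : ((0 : ℂ) : OnePoint ℂ) ∈ Ω) {ξ ξ' : ℂ}
    (hξ : ξ ∈ finitePart (sphereExt Ω)) (hξ' : ξ' ∈ finitePart (sphereExt Ω)) :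
    MemL1a Ω rho0 (testFun ξ ξ') := by
  have hne {a z : ℂ} (ha : a ∈ finitePart (sphereExt Ω)) (hz : (z : OnePoint ℂ) ∈ closure Ω) :
      z - a ≠ 0 := sub_ne_zero.2 fun h => ha (h ▸ hz)
  have hn0 {a : ℂ} (ha : a ∈ finitePart (sphereExt Ω)) : a ≠ 0 := by
    rintro rfl
    exact ha (subset_closure h0)
  have hd (z : ℂ) (hz : (z : OnePoint ℂ) ∈ closure Ω) :
      DifferentiableAt ℂ (fun z : ℂ => testFun ξ ξ' z) z := by
    simp only [testFun_coe]
    exact ((((differentiableAt_id).sub_const ξ).inv (hne hξ hz)).const_mul ξ).sub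
      ((((differentiableAt_id).sub_const ξ').inv (hne hξ' hz)).const_mul ξ')
  refine ⟨memA_of_tendsto hΩ.isOpen hΩ.infty_notMem_frontier
    (fun z hz => hd z (subset_closure hz)) (fun z hz => (hd z hz).continuousAt) fun _ => ?_,
    (integrable_testFun_mul_rho0 (hn0 hξ) (hn0 hξ')).integrableOn⟩
  simp only [testFun_coe, testFun_infty]
  have hlim (a : ℂ) : Filter.Tendsto (fun z : ℂ => a * (z - a)⁻¹) (Bornology.cobounded ℂ)
      (nhds 0) := by
    simpa using (Filter.tendsto_inv₀_cobounded.comp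
      (tendsto_sub_const_cobounded a)).const_mul a
  simpa using (hlim ξ).sub (hlim ξ')

/-- Here `κ` is `0` or `1` according as `∞` lies in `Ω` or not. -/
theorem IsLQD.separates (hΩ : IsLQD Ω h) {Γ : CurveFamily} (hΓ : Γ.IsBoundary Ω) :
    Γ.Separates (finitePart (frontier Ω)) (finitePart Ω) (finitePart (sphereExt Ω))
      (1 - Set.indicator Ω (fun _ => (1 : ℂ)) OnePoint.infty) where
  isCompact := by
    have := isCompact_finitePart_compl (isClosed_frontier (s := Ω)).isOpen_compl
      hΩ.infty_notMem_frontier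
    rwa [compl_compl] at this
  mem := hΓ.1
  disjoint_left z hz hz' := by
    have hz2 : (z : OnePoint ℂ) ∈ frontier Ω := hz
    rw [hΩ.frontier_eq] at hz2
    exact hz2.2 hz'
  disjoint_right z hz hz' := hz' (frontier_subset_closure hz)
  disjoint z hz hz' := hz' (subset_closure hz)
  index_left a ha := by
    have haΩ : (a : OnePoint ℂ) ∈ Ω := ha
    rw [hΓ.2 a (by rw [hΩ.frontier_eq]; exact fun h => h.2 haΩ), Set.indicator_of_mem haΩ]
  index_right a ha := by
    rw [hΓ.2 a fun h => ha (frontier_subset_closure h),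
      Set.indicator_of_notMem fun h => ha (subset_closure h)]
    ring

theorem IsLQD.areaIntegral_testFun (hΩ : IsLQD Ω h) (h0 : ((0 : ℂ) : OnePoint ℂ) ∈ Ω) {ξ ξ' : ℂ}
    (hξ : ξ ∈ finitePart (sphereExt Ω)) (hξ' : ξ' ∈ finitePart (sphereExt Ω)) :
    areaIntegral Ω (fun w => testFun ξ ξ' w * (rho0 w : ℂ)) =
      -(ξ * ratVal h ξ) + ξ' * ratVal h ξ' := by
  obtain ⟨Γ, hΓ, hq⟩ := hΩ.quadrature
  rw [hq _ (hΩ.memL1a_testFun h0 hξ hξ')]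
  have hs := hΩ.separates hΓ
  have hκ : 1 - Set.indicator Ω (fun _ => (1 : ℂ)) OnePoint.infty = 0 ∨
      h.num.degree < h.denom.degree := by
    by_cases hinf : OnePoint.infty ∈ Ω
    · exact Or.inl (by simp [hinf])
    · exact Or.inr (hΩ.admissible.2 hinf)
  have hC := hs.cauchyFormula_ratVal hΩ.admissible.1 hκ
  have hcont (a : ℂ) (ha : a ∈ finitePart (sphereExt Ω)) :
      ContinuousOn (fun w => a * (ratVal h w * (w - a)⁻¹)) (finitePart (frontier Ω)) :=
    continuousOn_const.mul (hC.1.mul (CurveFamily.Separates.continuousOn_inv_sub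
      fun h => hs.disjoint_right a h ha))
  have hfun : (fun w : ℂ => testFun ξ ξ' w * ratVal h w) =
      fun w => ξ * (ratVal h w * (w - ξ)⁻¹) - ξ' * (ratVal h w * (w - ξ')⁻¹) := by
    ext w
    rw [testFun_coe]
    ring
  rw [hfun, CurveFamily.integral_sub hs.isCompact hs.mem (hcont ξ hξ) (hcont ξ' hξ'),
    CurveFamily.integral_const_mul, CurveFamily.integral_const_mul, hC.2 ξ hξ, hC.2 ξ' hξ']
  ring

/-- The complement of `Ω` agrees with the exterior up to a null set. On the exterior the weight is
bounded, so there the two Cauchy kernels may be integrated separately. -/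
theorem IsLQD.integral_testFun_eq_add (hΩ : IsLQD Ω h) (h0 : ((0 : ℂ) : OnePoint ℂ) ∈ Ω)
    {ξ ξ' : ℂ} (hξ : ξ ∈ finitePart (sphereExt Ω)) (hξ' : ξ' ∈ finitePart (sphereExt Ω)) :
    ∫ w : ℂ, testFun ξ ξ' w * (rho0 w : ℂ) =
      (∫ w in finitePart Ω, testFun ξ ξ' w * (rho0 w : ℂ)) +
        (-(ξ * planeCauchy (finitePart (sphereExt Ω)) ξ) +
          ξ' * planeCauchy (finitePart (sphereExt Ω)) ξ') := by
  obtain ⟨δ, hδ, hEδ⟩ := hΩ.exists_le_norm h0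
  have hE := isOpen_finitePart (isOpen_sphereExt Ω)
  have hn0 {a : ℂ} (ha : a ∈ finitePart (sphereExt Ω)) : a ≠ 0 := by
    rintro rfl
    exact ha (subset_closure h0)
  rw [← integral_add_compl (isOpen_finitePart hΩ.isOpen).measurableSet
    (integrable_testFun_mul_rho0 (hn0 hξ) (hn0 hξ'))]
  congr 1
  have hcompl : (finitePart Ω)ᶜ = closure (finitePart (sphereExt Ω)) := by
    rw [closure_finitePart, hΩ.closure_sphereExt]
    rfl
  have hae : closure (finitePart (sphereExt Ω)) =ᵐ[volume] finitePart (sphereExt Ω) :=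
    closure_ae_eq_of_null_frontier hΩ.volume_frontier
  rw [hcompl, setIntegral_congr_set hae]
  have hfun : (fun w : ℂ => testFun ξ ξ' w * (rho0 w : ℂ)) =
      fun w => -ξ * ((rho0 w : ℂ) / (ξ - w)) + ξ' * ((rho0 w : ℂ) / (ξ' - w)) := by
    ext w
    rw [testFun_coe, ← neg_sub ξ w, ← neg_sub ξ' w, inv_neg, inv_neg]
    ring
  rw [hfun, integral_add ((integrableOn_kernel hE hδ hEδ ξ).const_mul _)
    ((integrableOn_kernel hE hδ hEδ ξ').const_mul _), integral_const_mul, integral_const_mul]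
  simp only [planeCauchy]
  ring

/-- The function `w h(w) + w G(w) - log |w|²`, which is constant on the exterior. -/
def coincidenceDefect (Ω : Set (OnePoint ℂ)) (h : RatFunc ℂ) (w : ℂ) : ℂ :=
  w * ratVal h w + w * cauchyTransform rho0 (sphereExt Ω) (w : OnePoint ℂ) -
    (Real.log (‖w‖ ^ 2) : ℂ)

theorem IsLQD.coincidenceDefect_eq (hΩ : IsLQD Ω h) (h0 : ((0 : ℂ) : OnePoint ℂ) ∈ Ω)
    {ξ ξ' : ℂ} (hξ : ξ ∈ finitePart (sphereExt Ω)) (hξ' : ξ' ∈ finitePart (sphereExt Ω)) :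
    coincidenceDefect Ω h ξ = coincidenceDefect Ω h ξ' := by
  have hn0 {a : ℂ} (ha : a ∈ finitePart (sphereExt Ω)) : a ≠ 0 := by
    rintro rfl
    exact ha (subset_closure h0)
  have h1 := hΩ.integral_testFun_eq_add h0 hξ hξ'
  rw [integral_testFun_mul_rho0 (hn0 hξ) (hn0 hξ')] at h1
  have h2 := hΩ.areaIntegral_testFun h0 hξ hξ'
  have hpi : (Real.pi : ℂ) ≠ 0 := by exact_mod_cast Real.pi_ne_zero
  rw [areaIntegral, eq_sub_of_add_eq h1.symm] at h2
  simp only [coincidenceDefect, cauchyTransform_coe, Real.log_pow]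
  push_cast at h2 ⊢
  field_simp at h2 ⊢
  linear_combination h2

theorem IsLQD.continuousOn_coincidenceDefect (hΩ : IsLQD Ω h)
    (h0 : ((0 : ℂ) : OnePoint ℂ) ∈ Ω) :
    ContinuousOn (coincidenceDefect Ω h) (closure (finitePart (sphereExt Ω))) := by
  obtain ⟨δ, hδ, hEδ⟩ := hΩ.exists_le_norm h0
  have hG := continuous_planeCauchy (isOpen_finitePart (isOpen_sphereExt Ω)) hδ hEδ
    hΩ.volume_frontier
  have hval : ratVal h = fun z => h.num.eval z / h.denom.eval z := by
    ext z
    simp [ratVal, RatFunc.eval, Polynomial.eval₂_eq_eval_map]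
  rw [closure_finitePart, hΩ.closure_sphereExt]
  have hr : ContinuousOn (ratVal h) (finitePart Ωᶜ) := by
    rw [hval]
    exact h.num.continuous.continuousOn.div h.denom.continuous.continuousOn
      fun z hz hz0 => hz (hΩ.admissible.1 z hz0)
  have hl : ContinuousOn (fun w : ℂ => (Real.log (‖w‖ ^ 2) : ℂ)) (finitePart Ωᶜ) := by
    refine Complex.continuous_ofReal.comp_continuousOn (ContinuousOn.log (by fun_prop) ?_)
    intro z hz
    have : z ≠ 0 := by
      rintro rfl
      exact hz h0
    positivity
  have hg : ContinuousOn (fun w : ℂ => cauchyTransform rho0 (sphereExt Ω) (w : OnePoint ℂ))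
      (finitePart Ωᶜ) := by
    simp only [cauchyTransform_coe]
    exact (continuous_const.mul hG).continuousOn
  exact ((continuousOn_id.mul hr).add (continuousOn_id.mul hg)).sub hl

theorem IsLQD.coincidenceEq (hΩ : IsLQD Ω h) (h0 : ((0 : ℂ) : OnePoint ℂ) ∈ Ω) {ξ : ℂ}
    (hξ : ξ ∈ finitePart (sphereExt Ω)) :
    CoincidenceEq Ω h (-coincidenceDefect Ω h ξ) (cauchyTransform rho0 (sphereExt Ω)) := by
  have heq : Set.EqOn (coincidenceDefect Ω h) (fun _ => coincidenceDefect Ω h ξ)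
      (closure (finitePart (sphereExt Ω))) :=
    Set.EqOn.of_subset_closure (fun z hz => hΩ.coincidenceDefect_eq h0 hz hξ)
      (hΩ.continuousOn_coincidenceDefect h0) continuousOn_const subset_closure subset_rfl
  intro w hw
  have hwΩ : (w : OnePoint ℂ) ∉ Ω := by
    rw [hΩ.frontier_eq] at hw
    exact hw.2
  have hw0 : w ≠ 0 := by
    rintro rfl
    exact hwΩ h0
  have hmem : w ∈ closure (finitePart (sphereExt Ω)) := by
    rw [closure_finitePart, hΩ.closure_sphereExt]
    exact hwΩ
  have := heq hmem
  simp only [coincidenceDefect] at this ⊢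
  rw [← this]
  field_simp
  ring

end LQD

end

theorem theorem2p3 (Ω : Set (OnePoint ℂ)) (h : RatFunc ℂ)
    (hΩ : LQD.IsLQD Ω h) (h0 : ((0 : ℂ) : OnePoint ℂ) ∈ Ω) (hne : Ω ≠ Set.univ) :
    ∃ (q : ℂ) (G : OnePoint ℂ → ℂ),
      LQD.MemA Ω G ∧ LQD.CoincidenceEq Ω h q G ∧
      (∀ w ∈ closure Ω,
        MeasureTheory.IntegrableOn (LQD.cauchyKernel LQD.rho0 w)
          (LQD.finitePart (LQD.sphereExt Ω)) ∧
        G w = LQD.cauchyTransform LQD.rho0 (LQD.sphereExt Ω) w) ∧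
      ∀ (q' : ℂ) (G' : OnePoint ℂ → ℂ), LQD.MemA Ω G' → LQD.CoincidenceEq Ω h q' G' →
        q' = q ∧ Set.EqOn G' G (closure Ω) := by
  obtain ⟨ξ, hξ⟩ := hΩ.nonempty_finitePart_sphereExt hne
  have hG := hΩ.memA_cauchyTransform h0
  have hco := hΩ.coincidenceEq h0 hξ
  refine ⟨_, _, hG, hco, fun w _ => ⟨?_, rfl⟩, fun q' G' hG' hco' => ?_⟩
  · induction w using OnePoint.rec with
    | infty => exact MeasureTheory.integrableOn_zero
    | coe w =>
      obtain ⟨δ, hδ, hEδ⟩ := hΩ.exists_le_norm h0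
      exact LQD.integrableOn_kernel (LQD.isOpen_finitePart (LQD.isOpen_sphereExt Ω)) hδ hEδ w
  -- Subtracting the two coincidence equations gives `G' - G = (q - q') / w` on `∂Ω`; the point `ξ`
  -- serves as the exterior point sent to infinity.
  · obtain ⟨hc, hD⟩ := (hG'.sub hG).eqOn_zero_of_eq_div
      (c := -LQD.coincidenceDefect Ω h ξ - q') hΩ.isOpen
      hΩ.infty_notMem_frontier h0 hξ fun w hw => by
        rw [sub_div]
        linear_combination hco w hw - hco' w hw
    exact ⟨(sub_eq_zero.1 hc).symm, fun x hx => sub_eq_zero.1 (hD hx)⟩
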